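/- Let $A\to M$ be a smooth real vector bundle of rank $N$ over a smooth manifold, with a Lie algebroid structure (anchor $\rho$, bracket $[\,,]$, differential $d_A$ on $\Gamma(\wedge^\bullet A^*)$, $\mathcal L_X=i_Xd_A+d_Ai_X$), and let $(\pi,\psi)$ be a twisted Poisson structure on $A$: $\pi\in\Gamma(\wedge^2A)$, $\psi\in\Gamma(\wedge^3A^*)$, $d_A\psi=0$ and $\tfrac12[\pi,\pi]=(\wedge^3\pi^\sharp)\psi$, where $[\pi,\pi]$ is the Schouten bracket and $\langle\beta,\pi^\sharp\alpha\rangle=\pi(\alpha,\beta)$. Assume that $A$ is orientable, and let $\lambda\in\Gamma(\wedge^NA^*)$ be nowhere vanishing. Notation. Interior products satisfy $i_{X\wedge Y}=i_X\circ i_Y$; for a form $\mu$ of degree $N$, $*_\mu V=i_V\mu$. Put $\psi^{(2)}(\alpha,\beta)=\psi(\pi^\sharp\alpha,\pi^\sharp\beta,\cdot)$, $\partial_\pi=d_Ai_\pi-i_\pi d_A$, and $\underline\partial_{\pi,\psi}=i_{\psi^{(2)}}$, where $i_{\xi\otimes Q}\alpha=\xi\wedge i_Q\alpha$ for a $1$-form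 $\xi$ and a bivector $Q$. The section $Y=Y_{\pi,\psi}$ of $A$ is defined by $\langle\alpha,Y\rangle=\tfrac12\operatorname{Tr}\big(\beta\mapsto\psi^{(2)}(\alpha,\beta)\big)$, and $X_{\pi,\lambda}$ by $\langle\alpha,X_{\pi,\lambda}\rangle\lambda=\mathcal L_{\pi^\sharp\alpha}\lambda-(i_\pi d_A\alpha)\lambda$ for all $\alpha\in\Gamma(A^*)$. Let $d_{\pi,\psi}$ be the differential on $\Gamma(\wedge^\bullet A)$ of the Lie algebroid $A^*$ with anchor $\rho\circ\pi^\sharp$ and bracket $$[\alpha,\beta]_{\pi,\psi}=\mathcal L_{\pi^\sharp\alpha}\beta-\mathcal L_{\pi^\sharp\beta}\alpha-d_A(\pi(\alpha,\beta))+\psi^{(2)}(\alpha,\beta).$$ The modular section is $Z_\lambda=X_{\pi,\lambda}+Y_{\pi,\psi}$, and $(A,\pi,\psi)$ is unimodular if its $d_{\pi,\psi}$-cohomology class (the modular class) vanishes. Let $H_\bullet^{\pi,\psi}(A)$ be the homology of $(\Gamma(\wedge^\bullet A^*),\ \partial_\pi+\underline\partial_{\pi,\psi}+i_Y)$ and $H^\bullet_{\pi,\psi}(A^*)$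 the cohomology of $(\Gamma(\wedge^\bullet A),d_{\pi,\psi})$. Proposition. If $(A,\pi,\psi)$ is unimodular, then $H_k^{\pi,\psi}(A)\simeq H^{N-k}_{\pi,\psi}(A^*)$ for all $k\in\mathbb N$ (both are $0$ for $k>N$). The isomorphism is defined at the chain level: there is a function $g\in C^\infty(M)$ with $Z_\lambda=H_g:=\pi^\sharp(d_Ag)$; for every such $g$ and $f=e^{g}$, all the maps $*_{f\lambda}:\Gamma(\wedge^pA)\to\Gamma(\wedge^{N-p}A^*)$ are bijective, they satisfy $$(\partial_\pi+\underline\partial_{\pi,\psi}+i_Y)\,*_{f\lambda}V=-*_{f\lambda}d_{\pi,\psi}V$$ for all $V\in\Gamma(\wedge^pA)$, $0\le p<N$, and $[V]\mapsto[*_{f\lambda}V]$ is a well-defined isomorphism $H^{N-k}_{\pi,\psi}(A^*)\to H_k^{\pi,\psi}(A)$ for $0\le k\le N$. -/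

import Mathlib

open scoped Manifold ContDiff Topology
open Bundle (TotalSpace)

set_option linter.unusedSectionVars false
set_option linter.unusedSimpArgs false

namespace TwistedPoisson

section Algebra

variable {R L : Type*} [CommRing R] [Algebra ℝ R] [AddCommGroup L] [Module ℝ L] [Module R L]
  [IsScalarTower ℝ R L]

/-- `q`-forms on an `R`-module `L`: alternating `R`-multilinear maps `L^q → R`. -/
abbrev Form (R L : Type*) [CommRing R] [AddCommGroup L] [Module R L] (q : ℕ) : Type _ :=
  L [⋀^Fin q]→ₗ[R] R

/-- `p`-vectors: alternating `R`-multilinear maps in `p` elements of the dual of `L`. -/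
abbrev MultiVector (R L : Type*) [CommRing R] [AddCommGroup L] [Module R L] (p : ℕ) : Type _ :=
  Form R (Form R L 1) p

instance (q : ℕ) : IsScalarTower ℝ R (Form R L q) :=
  ⟨fun c f α => by ext v; simp⟩


/-- An anchor, and a skew bracket satisfying the Leibniz rule. This is the part of the data of a
Lie-Rinehart algebra (the sections of a Lie algebroid) that is needed to write down the differential. -/
structure SkewAlgebroid (R L : Type*) [CommRing R] [Algebra ℝ R] [AddCommGroup L] [Module ℝ L]
    [Module R L] where
  anchor : L →ₗ[R] Derivation ℝ R R
  bracket : L →ₗ[ℝ] L →ₗ[ℝ] L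
  bracket_self : ∀ a, bracket a a = 0
  leibniz : ∀ (a b : L) (f : R), bracket a (f • b) = f • bracket a b + anchor a f • b

namespace SkewAlgebroid

variable (𝒜 : SkewAlgebroid R L)

/-- The sum `∑_{k < l} (-1)^{k+l} α([a_k, a_l], a_0, …, a_q)`, with `a_k` and `a_l` omitted from
the list (in the code the second index is `l + 1`). -/
def bracketTerm : (q : ℕ) → Form R L q → (Fin (q + 1) → L) → R
  | 0, _, _ => 0
  | q + 1, α, a => ∑ k : Fin (q + 1), ∑ l ≥ k, (-1 : ℤ) ^ ((k : ℕ) + (l + 1)) •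
      α (Matrix.vecCons (𝒜.bracket (a k.castSucc) (a l.succ))
        (l.removeNth (k.castSucc.removeNth a)))

/-- The value of the differential of `α` on `(a_0, …, a_q)`:
`∑ (-1)^k ρ(a_k) α(a_0, …, a_q) + ∑_{k < l} (-1)^{k+l} α([a_k, a_l], a_0, …, a_q)`, where
`a_k`, respectively `a_k` and `a_l`, are omitted. -/
def dFun (q : ℕ) (α : Form R L q) (a : Fin (q + 1) → L) : R :=
  ∑ k : Fin (q + 1), (-1 : ℤ) ^ (k : ℕ) • 𝒜.anchor (a k) (α (k.removeNth a)) + 𝒜.bracketTerm q α a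

lemma bracket_swap (a b : L) : 𝒜.bracket a b = -𝒜.bracket b a := by
  have h := 𝒜.bracket_self (a + b)
  simp only [map_add, LinearMap.add_apply, 𝒜.bracket_self, zero_add, add_zero] at h
  exact eq_neg_of_add_eq_zero_right h

lemma leibniz_left (a b : L) (f : R) :
    𝒜.bracket (f • a) b = f • 𝒜.bracket a b - 𝒜.anchor b f • a := by
  rw [bracket_swap, 𝒜.leibniz, bracket_swap 𝒜 b a]; simp [sub_eq_add_neg]; abel

def realForm {q : ℕ} (α : Form R L q) : L [⋀^Fin q]→ₗ[ℝ] R :=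
  { α.toMultilinearMap.restrictScalars ℝ with
    map_eq_zero_of_eq' := fun v _ _ h h' => α.map_eq_zero_of_eq v h h' }

def anchorPart {q : ℕ} (α : Form R L q) : L →ₗ[ℝ] L [⋀^Fin q]→ₗ[ℝ] R where
  toFun a := (𝒜.anchor a : R →ₗ[ℝ] R).compAlternatingMap (realForm α)
  map_add' a b := by ext; simp
  map_smul' c a := by
    ext v
    have : 𝒜.anchor (c • a) = c • 𝒜.anchor a := by
      rw [← algebraMap_smul R c a, map_smul, algebraMap_smul]
    simp [this]

def bracketPart {q : ℕ} (α : Form R L (q + 1)) : L →ₗ[ℝ] L →ₗ[ℝ] L [⋀^Fin q]→ₗ[ℝ] R :=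
  𝒜.bracket.compr₂ (realForm α).curryLeft

/-- Auxiliary: the differential as an `ℝ`-multilinear map, before `R`-linearity is known. -/
noncomputable def dReal : (q : ℕ) → (α : Form R L q) → L [⋀^Fin (q + 1)]→ₗ[ℝ] R
  | 0, α => AlternatingMap.alternatizeUncurryFin (𝒜.anchorPart α)
  | _ + 1, α => AlternatingMap.alternatizeUncurryFin (𝒜.anchorPart α) -
      (1 / 2 : ℝ) • AlternatingMap.alternatizeUncurryFin
        (AlternatingMap.alternatizeUncurryFinLM ∘ₗ 𝒜.bracketPart α)

lemma realForm_apply {q : ℕ} (α : Form R L q) (v : Fin q → L) : realForm α v = α v := rfl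

lemma dReal_apply (q : ℕ) (α : Form R L q) (a : Fin (q + 1) → L) :
    𝒜.dReal q α a = 𝒜.dFun q α a := by
  cases q with
  | zero =>
    simp [dReal, dFun, bracketTerm, AlternatingMap.alternatizeUncurryFin_apply, anchorPart,
      realForm_apply]
  | succ q =>
    simp only [dReal, dFun, bracketTerm, AlternatingMap.sub_apply, AlternatingMap.smul_apply,
      AlternatingMap.alternatizeUncurryFin_alternatizeUncurryFinLM_comp_apply]
    rw [sub_eq_add_neg]
    congr 1
    · simp [AlternatingMap.alternatizeUncurryFin_apply, anchorPart, realForm_apply]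
    · rw [Finset.smul_sum, ← Finset.sum_neg_distrib]
      refine Finset.sum_congr rfl fun k _ => ?_
      rw [Finset.smul_sum, ← Finset.sum_neg_distrib]
      refine Finset.sum_congr rfl fun l _ => ?_
      have h : 𝒜.bracketPart α (a l.succ) (a k.castSucc) =
          -𝒜.bracketPart α (a k.castSucc) (a l.succ) := by
        simp [bracketPart, bracket_swap 𝒜 (a l.succ)]
      rw [h, AlternatingMap.neg_apply, sub_neg_eq_add, ← two_smul ℝ, smul_comm (1 / 2 : ℝ),
        smul_smul]
      simp [bracketPart, realForm_apply, pow_add]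

lemma form_cons_smul {q : ℕ} (β : Form R L (q + 1)) (f : R) (x : L) (u : Fin q → L) :
    β (Matrix.vecCons (f • x) u) = f * β (Matrix.vecCons x u) :=
  β.toMultilinearMap.cons_smul u f x

lemma removeNth_succ_cons {n : ℕ} (x : L) (u : Fin (n + 1) → L) (k : Fin (n + 1)) :
    k.succ.removeNth (Matrix.vecCons x u : Fin (n + 2) → L) = Matrix.vecCons x (k.removeNth u) := by
  ext j; refine Fin.cases ?_ (fun j => ?_) j <;> simp [Fin.removeNth_apply]

lemma removeNth_zero_cons {n : ℕ} (x : L) (u : Fin n → L) :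
    (0 : Fin (n + 1)).removeNth (Matrix.vecCons x u : Fin (n + 1) → L) = u := by
  ext j; simp [Fin.removeNth_apply]

lemma anchorAlt_cons_smul (q : ℕ) (α : Form R L (q + 1)) (f : R) (a : L) (w : Fin (q + 1) → L) :
    AlternatingMap.alternatizeUncurryFin (𝒜.anchorPart α) (Matrix.vecCons (f • a) w) =
      f • AlternatingMap.alternatizeUncurryFin (𝒜.anchorPart α) (Matrix.vecCons a w) -
      ∑ k : Fin (q + 1), (-1 : ℤ) ^ (k : ℕ) •
        (𝒜.anchor (w k) f * α (Matrix.vecCons a (k.removeNth w))) := by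
  simp only [AlternatingMap.alternatizeUncurryFin_apply, anchorPart, LinearMap.coe_mk,
    AddHom.coe_mk, LinearMap.compAlternatingMap_apply, realForm_apply]
  simp only [Fin.sum_univ_succ (n := q + 1)]
  simp only [Fin.val_zero, pow_zero, one_smul, Matrix.cons_val_zero, removeNth_zero_cons,
    Matrix.cons_val_succ, removeNth_succ_cons, Fin.val_succ, form_cons_smul, map_smul]
  rw [smul_add, add_sub_assoc, Finset.smul_sum, ← Finset.sum_sub_distrib]
  congr 1
  refine Finset.sum_congr rfl fun k _ => ?_
  simp [pow_succ]
  ring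

lemma bracketAlt_cons_smul (q : ℕ) (α : Form R L (q + 1)) (f : R) (a : L) (w : Fin (q + 1) → L) :
    AlternatingMap.alternatizeUncurryFin (AlternatingMap.alternatizeUncurryFinLM ∘ₗ
        𝒜.bracketPart α) (Matrix.vecCons (f • a) w) =
      f • AlternatingMap.alternatizeUncurryFin (AlternatingMap.alternatizeUncurryFinLM ∘ₗ
        𝒜.bracketPart α) (Matrix.vecCons a w) -
      2 * ∑ k : Fin (q + 1), (-1 : ℤ) ^ (k : ℕ) •
        (𝒜.anchor (w k) f * α (Matrix.vecCons a (k.removeNth w))) := by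
  have key : ∀ x : L, AlternatingMap.alternatizeUncurryFin (AlternatingMap.alternatizeUncurryFinLM ∘ₗ
        𝒜.bracketPart α) (Matrix.vecCons x w) =
      2 * ∑ k : Fin (q + 1), (-1 : ℤ) ^ (k : ℕ) •
        α (Matrix.vecCons (𝒜.bracket x (w k)) (k.removeNth w)) +
      ∑ k : Fin (q + 1), (-1 : ℤ) ^ (k + 1 : ℕ) • (AlternatingMap.alternatizeUncurryFin
        (𝒜.bracketPart α (w k)) (Matrix.vecCons x (k.removeNth w)) -
        α (Matrix.vecCons (𝒜.bracket (w k) x) (k.removeNth w))) := by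
    intro x
    rw [AlternatingMap.alternatizeUncurryFin_apply, Fin.sum_univ_succ]
    simp only [Fin.val_zero, pow_zero, one_smul, Matrix.cons_val_zero, removeNth_zero_cons,
      Matrix.cons_val_succ, removeNth_succ_cons, Fin.val_succ, LinearMap.comp_apply,
      AlternatingMap.alternatizeUncurryFinLM_apply, smul_sub, Finset.sum_sub_distrib]
    have h0 : AlternatingMap.alternatizeUncurryFin (𝒜.bracketPart α x) w =
        ∑ k : Fin (q + 1), (-1 : ℤ) ^ (k : ℕ) •
        α (Matrix.vecCons (𝒜.bracket x (w k)) (k.removeNth w)) := by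
      simp [AlternatingMap.alternatizeUncurryFin_apply, bracketPart, realForm_apply]
    have h1 : ∑ k : Fin (q + 1), (-1 : ℤ) ^ (k + 1 : ℕ) •
        α (Matrix.vecCons (𝒜.bracket (w k) x) (k.removeNth w)) =
        ∑ k : Fin (q + 1), (-1 : ℤ) ^ (k : ℕ) •
        α (Matrix.vecCons (𝒜.bracket x (w k)) (k.removeNth w)) := by
      refine Finset.sum_congr rfl fun k _ => ?_
      rw [bracket_swap 𝒜 (w k) x, ← neg_one_smul R (𝒜.bracket x (w k)), form_cons_smul, pow_succ]
      simp
    rw [h0, h1]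
    ring
  have hom : ∀ k : Fin (q + 1), AlternatingMap.alternatizeUncurryFin
        (𝒜.bracketPart α (w k)) (Matrix.vecCons (f • a) (k.removeNth w)) -
        α (Matrix.vecCons (𝒜.bracket (w k) (f • a)) (k.removeNth w)) =
      f * (AlternatingMap.alternatizeUncurryFin
        (𝒜.bracketPart α (w k)) (Matrix.vecCons a (k.removeNth w)) -
        α (Matrix.vecCons (𝒜.bracket (w k) a) (k.removeNth w))) := by
    intro k
    obtain _ | q := q
    · simp [AlternatingMap.alternatizeUncurryFin_apply, bracketPart, realForm_apply,
        removeNth_zero_cons]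
    · simp only [AlternatingMap.alternatizeUncurryFin_apply, bracketPart, LinearMap.compr₂_apply]
      simp only [Fin.sum_univ_succ (n := q + 1)]
      simp only [Fin.val_zero, pow_zero, one_smul, Matrix.cons_val_zero, removeNth_zero_cons,
        Matrix.cons_val_succ, removeNth_succ_cons, Fin.val_succ, AlternatingMap.curryLeft_apply_apply,
        realForm_apply, add_sub_cancel_left]
      rw [Finset.mul_sum]
      refine Finset.sum_congr rfl fun j _ => ?_
      have h2 : ∀ y : L, α (Matrix.vecCons (𝒜.bracket (w k) (k.removeNth w j))
          (Matrix.vecCons y (j.removeNth (k.removeNth w)))) =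
          (α.curryLeft (𝒜.bracket (w k) (k.removeNth w j)))
            (Matrix.vecCons y (j.removeNth (k.removeNth w))) := fun y => rfl
      rw [h2, h2, form_cons_smul, mul_smul_comm]
  rw [key, key]
  simp only [hom, leibniz_left, smul_add, sub_eq_add_neg (f • _), ← neg_smul]
  have h3 : ∀ k : Fin (q + 1), α (Matrix.vecCons (f • 𝒜.bracket a (w k) +
      (-𝒜.anchor (w k) f) • a) (k.removeNth w)) =
      f * α (Matrix.vecCons (𝒜.bracket a (w k)) (k.removeNth w)) -
      𝒜.anchor (w k) f * α (Matrix.vecCons a (k.removeNth w)) := by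
    intro k
    have h4 : ∀ y z : L, α (Matrix.vecCons (y + z) (k.removeNth w)) =
        α (Matrix.vecCons y (k.removeNth w)) + α (Matrix.vecCons z (k.removeNth w)) :=
      fun y z => α.toMultilinearMap.cons_add _ _ _
    rw [h4, form_cons_smul, form_cons_smul]; ring
  simp only [h3, smul_eq_mul, smul_sub, Finset.sum_sub_distrib, mul_add, Finset.mul_sum, mul_sub,
    mul_smul_comm]
  simp only [mul_left_comm]
  ring

lemma dReal_cons_smul (q : ℕ) (α : Form R L q) (f : R) (a : L) (w : Fin q → L) :
    𝒜.dReal q α (Matrix.vecCons (f • a) w) = f • 𝒜.dReal q α (Matrix.vecCons a w) := by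
  cases q with
  | zero =>
    simp [dReal, AlternatingMap.alternatizeUncurryFin_apply, anchorPart, realForm_apply,
      removeNth_zero_cons]
  | succ q =>
    simp only [dReal, AlternatingMap.sub_apply, AlternatingMap.smul_apply, anchorAlt_cons_smul,
      bracketAlt_cons_smul, smul_sub]
    rw [← smul_one_mul (1 / 2 : ℝ) (2 * _ : R), ← mul_assoc, smul_mul_assoc, one_mul,
      show (1 / 2 : ℝ) • (2 : R) = 1 by
        rw [show (2 : R) = (2 : ℝ) • (1 : R) by rw [two_smul, one_add_one_eq_two], smul_smul]
        norm_num,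
      smul_comm f (1 / 2 : ℝ)]
    ring

/-- The differential on `q`-forms; its values are those of `dFun`. -/
noncomputable def d (q : ℕ) : Form R L q →ₗ[ℝ] Form R L (q + 1) where
  toFun α :=
    { toFun := 𝒜.dFun q α
      map_update_add' := by
        intro inst v i x y
        obtain rfl : inst = instDecidableEqFin (q + 1) := Subsingleton.elim _ _
        simp only [← dReal_apply]
        exact (𝒜.dReal q α).map_update_add v i x y
      map_update_smul' := by
        intro inst v i c x
        obtain rfl : inst = instDecidableEqFin (q + 1) := Subsingleton.elim _ _
        simp only [← dReal_apply]
        have hz : ∀ (u : Fin (q + 1) → L), 𝒜.dReal q α (Function.update u 0 (c • x)) =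
            c • 𝒜.dReal q α (Function.update u 0 x) := by
          intro u
          have : ∀ y, Function.update u 0 y = Matrix.vecCons y (fun j => u j.succ) := by
            intro y; ext j; refine Fin.cases ?_ (fun j => ?_) j <;> simp
          rw [this, this, dReal_cons_smul]
        by_cases hi : i = 0
        · subst hi; exact hz v
        · have hs : ∀ y, Function.update v i y =
              Function.update (v ∘ Equiv.swap 0 i) 0 y ∘ Equiv.swap 0 i := by
            intro y; ext j
            by_cases h1 : j = i
            · subst h1; simp
            · by_cases h2 : j = 0
              · subst h2; simp [Function.update_of_ne hi, Function.update_of_ne h1]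
              · simp [Function.update_of_ne h1, Equiv.swap_apply_of_ne_of_ne h2 h1,
                  Function.update_of_ne h2]
          rw [hs, hs, AlternatingMap.map_swap _ _ (Ne.symm hi),
            AlternatingMap.map_swap _ _ (Ne.symm hi), hz, smul_neg]
      map_eq_zero_of_eq' := by
        intro v i j h hij
        rw [← dReal_apply]
        exact (𝒜.dReal q α).map_eq_zero_of_eq v h hij }
  map_add' α β := by
    ext a
    cases q <;> (simp [dFun, bracketTerm, Finset.sum_add_distrib]; try abel)
  map_smul' c α := by
    ext a
    cases q <;> simp [dFun, bracketTerm, Finset.smul_sum, smul_comm c]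

end SkewAlgebroid

/-- contraction of a form with a section in its first slot -/
def iota {q : ℕ} (X : L) (α : Form R L (q + 1)) : Form R L q := α.curryLeft X

/-- The Lie derivation of forms, `L_X = [i_X, d] = i_X d + d i_X`. -/
noncomputable def SkewAlgebroid.lieDeriv (𝒜 : SkewAlgebroid R L) (X : L) :
    (q : ℕ) → Form R L q → Form R L q
  | 0, α => iota X (𝒜.d 0 α)
  | q + 1, α => iota X (𝒜.d (q + 1) α) + 𝒜.d q (iota X α)

/-- A function, as a `0`-form. -/
def fnForm (f : R) : Form R L 0 := AlternatingMap.constOfIsEmpty R L (Fin 0) f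

end Algebra

section Geometry

/-- Smooth real functions on `M`. -/
abbrev SmoothFn (E M : Type*) [NormedAddCommGroup E] [NormedSpace ℝ E] [TopologicalSpace M]
    [ChartedSpace E M] : Type _ :=
  C^∞⟮𝓘(ℝ, E), M; 𝓘(ℝ, ℝ), ℝ⟯

variable {E M F : Type*} {A : M → Type*}
  [NormedAddCommGroup E] [NormedSpace ℝ E] [FiniteDimensional ℝ E]
  [TopologicalSpace M] [ChartedSpace E M] [IsManifold 𝓘(ℝ, E) ∞ M] [T2Space M]
  [NormedAddCommGroup F] [NormedSpace ℝ F] [FiniteDimensional ℝ F]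
  [TopologicalSpace (TotalSpace F A)] [∀ x, TopologicalSpace (A x)]
  [∀ x, AddCommGroup (A x)] [∀ x, Module ℝ (A x)]
  [FiberBundle F A] [VectorBundle ℝ F A] [ContMDiffVectorBundle ∞ F A 𝓘(ℝ, E)]

/-- Smooth sections of the vector bundle `A`. -/
abbrev Sec (E F : Type*) {M : Type*} (A : M → Type*)
    [NormedAddCommGroup E] [NormedSpace ℝ E] [TopologicalSpace M] [ChartedSpace E M]
    [NormedAddCommGroup F] [NormedSpace ℝ F]
    [TopologicalSpace (TotalSpace F A)] [∀ x, TopologicalSpace (A x)] [FiberBundle F A] : Type _ :=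
  Cₛ^∞⟮𝓘(ℝ, E); F, A⟯

noncomputable instance : Module (SmoothFn E M) (Sec E F A) where
  smul f s := ⟨fun x => f x • s x, f.contMDiff.smul_section s.contMDiff⟩
  one_smul s := by ext x; exact one_smul ℝ (s x)
  mul_smul f g s := by ext x; exact mul_smul (f x) (g x) (s x)
  smul_zero f := by ext x; exact smul_zero (f x)
  smul_add f s t := by ext x; exact smul_add (f x) (s x) (t x)
  add_smul f g s := by ext x; exact add_smul (f x) (g x) (s x)
  zero_smul s := by ext x; exact zero_smul ℝ (s x)

@[simp] lemma Sec.smul_apply (f : SmoothFn E M) (s : Sec E F A) (x : M) :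
    (f • s) x = f x • s x := rfl

instance : IsScalarTower ℝ (SmoothFn E M) (Sec E F A) :=
  ⟨fun c f s => by ext x; exact mul_smul c (f x) (s x)⟩

/-- `Γ(∧^q A*)`: alternating `C^∞(M)`-multilinear maps on sections of `A`. -/
abbrev DForm (E F : Type*) {M : Type*} (A : M → Type*)
    [NormedAddCommGroup E] [NormedSpace ℝ E] [TopologicalSpace M] [ChartedSpace E M]
    [NormedAddCommGroup F] [NormedSpace ℝ F]
    [TopologicalSpace (TotalSpace F A)] [∀ x, TopologicalSpace (A x)]
    [∀ x, AddCommGroup (A x)] [∀ x, Module ℝ (A x)] [FiberBundle F A] [VectorBundle ℝ F A]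
    (q : ℕ) : Type _ :=
  Form (SmoothFn E M) (Sec E F A) q

/-- `Γ(∧^p A)`: alternating `C^∞(M)`-multilinear maps on sections of `A*`. -/
abbrev MVec (E F : Type*) {M : Type*} (A : M → Type*)
    [NormedAddCommGroup E] [NormedSpace ℝ E] [TopologicalSpace M] [ChartedSpace E M]
    [NormedAddCommGroup F] [NormedSpace ℝ F]
    [TopologicalSpace (TotalSpace F A)] [∀ x, TopologicalSpace (A x)]
    [∀ x, AddCommGroup (A x)] [∀ x, Module ℝ (A x)] [FiberBundle F A] [VectorBundle ℝ F A]
    (p : ℕ) : Type _ :=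
  MultiVector (SmoothFn E M) (Sec E F A) p

/-- A Lie algebroid: a smooth vector bundle with a bundle map `anchor` to the tangent bundle and
a Lie bracket on its sections that satisfies the Leibniz rule. -/
structure LieAlgebroid (E F : Type*) {M : Type*} (A : M → Type*)
    [NormedAddCommGroup E] [NormedSpace ℝ E]
    [TopologicalSpace M] [ChartedSpace E M] [IsManifold 𝓘(ℝ, E) ∞ M]
    [NormedAddCommGroup F] [NormedSpace ℝ F]
    [TopologicalSpace (TotalSpace F A)] [∀ x, TopologicalSpace (A x)]
    [∀ x, AddCommGroup (A x)] [∀ x, Module ℝ (A x)]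
    [FiberBundle F A] [VectorBundle ℝ F A] where
  anchor : ∀ x, A x →ₗ[ℝ] TangentSpace 𝓘(ℝ, E) x
  anchor_smooth : ∀ a : Sec E F A, ContMDiff 𝓘(ℝ, E) (𝓘(ℝ, E).prod 𝓘(ℝ, E)) ∞
    (fun x => (⟨x, anchor x (a x)⟩ : TangentBundle 𝓘(ℝ, E) M))
  bracket : Sec E F A →ₗ[ℝ] Sec E F A →ₗ[ℝ] Sec E F A
  bracket_self : ∀ a, bracket a a = 0
  jacobi : ∀ a b c, bracket a (bracket b c) = bracket (bracket a b) c + bracket b (bracket a c)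
  leibniz : ∀ (a b : Sec E F A) (f : SmoothFn E M) (x : M), bracket a (f • b) x =
    f x • bracket a b x + mvfderiv 𝓘(ℝ, E) f x (anchor x (a x)) • b x
  anchor_bracket : ∀ (a b : Sec E F A) (x : M), anchor x (bracket a b x) =
    VectorField.mlieBracket 𝓘(ℝ, E) (fun y => anchor y (a y)) (fun y => anchor y (b y)) x

namespace LieAlgebroid

/-- The derivative of a function along the anchor of a section. -/
noncomputable def anchorFn (𝔄 : LieAlgebroid E F A) (a : Sec E F A) (f : SmoothFn E M) :
    SmoothFn E M :=
  ⟨fun x => mvfderiv 𝓘(ℝ, E) f x (𝔄.anchor x (a x)), by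
    exact (contMDiff_snd_tangentBundle_modelSpace ℝ 𝓘(ℝ, ℝ)).comp
      ((f.contMDiff.contMDiff_tangentMap (m := ∞) (by simp)).comp (𝔄.anchor_smooth a))⟩

@[simp] lemma anchorFn_apply (𝔄 : LieAlgebroid E F A) (a : Sec E F A) (f : SmoothFn E M) (x : M) :
    𝔄.anchorFn a f x = mvfderiv 𝓘(ℝ, E) f x (𝔄.anchor x (a x)) := rfl

/-- The anchor and bracket on the module of sections. -/
noncomputable def toSkew (𝔄 : LieAlgebroid E F A) : SkewAlgebroid (SmoothFn E M) (Sec E F A) where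
  anchor :=
    { toFun := fun a => Derivation.mk'
        { toFun := 𝔄.anchorFn a
          map_add' := fun f g => by
            ext x
            have h := mvfderiv_add (f.mdifferentiable x) (g.mdifferentiable x)
            simpa using congrArg (fun T => T (𝔄.anchor x (a x))) h
          map_smul' := fun c f => by
            ext x
            have h := mvfderiv_mul (mdifferentiableAt_const (c := c)) (f.mdifferentiable x)
            have h' := congrArg (fun T => T (𝔄.anchor x (a x))) h
            have h0 : mvfderiv 𝓘(ℝ, E) (fun _ : M => c) x (𝔄.anchor x (a x)) = 0 := by
              rw [mvfderiv, mfderiv_const]; rfl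
            simp only [add_apply, smul_apply, h0,
              smul_zero, add_zero] at h'
            exact h' }
        (fun f g => by
            ext x
            have h := mvfderiv_mul (f.mdifferentiable x) (g.mdifferentiable x)
            simpa using! congrArg (fun T => T (𝔄.anchor x (a x))) h)
      map_add' := fun a b => by
        ext f x
        change mvfderiv 𝓘(ℝ, E) f x (𝔄.anchor x (a x + b x)) =
          mvfderiv 𝓘(ℝ, E) f x (𝔄.anchor x (a x)) + mvfderiv 𝓘(ℝ, E) f x (𝔄.anchor x (b x))
        rw [map_add, map_add]
      map_smul' := fun f a => by
        ext g x
        change mvfderiv 𝓘(ℝ, E) g x (𝔄.anchor x (f x • a x)) =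
          f x • mvfderiv 𝓘(ℝ, E) g x (𝔄.anchor x (a x))
        rw [map_smul, map_smul] }
  bracket := 𝔄.bracket
  bracket_self := 𝔄.bracket_self
  leibniz a b f := by ext x; exact 𝔄.leibniz a b f x

end LieAlgebroid

/-- Auxiliary: sections `e_k` and `ε^k`, dual frames near `x₀` cut off by the bump function `χ`. -/
structure DualFrame (E F : Type*) {M : Type*} (A : M → Type*)
    [NormedAddCommGroup E] [NormedSpace ℝ E]
    [TopologicalSpace M] [ChartedSpace E M] 
    [NormedAddCommGroup F] [NormedSpace ℝ F]
    [TopologicalSpace (TotalSpace F A)] [∀ x, TopologicalSpace (A x)]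
    [∀ x, AddCommGroup (A x)] [∀ x, Module ℝ (A x)]
    [FiberBundle F A] [VectorBundle ℝ F A] (x₀ : M) where
  χ : SmoothFn E M
  χ_eq : ∀ᶠ x in 𝓝 x₀, χ x = 1
  e : Fin (Module.finrank ℝ F) → Sec E F A
  ε : Fin (Module.finrank ℝ F) → DForm E F A 1
  sum_eq : ∀ v : Sec E F A, χ • v = ∑ k, ε k ![v] • e k

lemma exists_dualFrame (x₀ : M) : Nonempty (DualFrame E F A x₀) := by
  classical
  have : ContMDiffVectorBundle 1 F A 𝓘(ℝ, E) := .of_le (n := ∞) (by simp)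
  let t := trivializationAt F A x₀
  have ht : x₀ ∈ t.baseSet := FiberBundle.mem_baseSet_trivializationAt' x₀
  let b := Module.finBasis ℝ F
  obtain ⟨ψ, hψ⟩ := ((SmoothBumpFunction.nhds_basis_tsupport (I := 𝓘(ℝ, E)) x₀).mem_iff).1
    (t.open_baseSet.mem_nhds ht)
  have hsupp : tsupport ψ ⊆ t.baseSet := hψ.2
  let e : Fin (Module.finrank ℝ F) → Sec E F A := fun i =>
    ⟨fun x => ψ x • t.localFrame b i x, ContMDiffOn.smul_section_of_tsupport
      ψ.contMDiff.contMDiffOn t.open_baseSet hsupp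
      (t.contMDiffOn_localFrame_baseSet (I := 𝓘(ℝ, E)) ∞ b i)⟩
  let c : Fin (Module.finrank ℝ F) → Sec E F A → SmoothFn E M := fun i s =>
    ⟨fun x => ψ x * t.localFrameCoeff 𝓘(ℝ, E) b i x (s x), by
      intro x
      by_cases hx : x ∈ t.baseSet
      · exact (ψ.contMDiff x).mul
          (contMDiffAt_localFrameCoeff b hx (s.contMDiff x) i)
      · have h0 : ψ =ᶠ[𝓝 x] 0 := notMem_tsupport_iff_eventuallyEq.1 fun h => hx (hsupp h)
        refine (contMDiffAt_const (c := (0 : ℝ))).congr_of_eventuallyEq ?_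
        filter_upwards [h0] with y hy
        simp [hy]⟩
  let ε : Fin (Module.finrank ℝ F) → DForm E F A 1 := fun i =>
    AlternatingMap.ofSubsingleton (SmoothFn E M) (Sec E F A) (SmoothFn E M) (0 : Fin 1)
      { toFun := c i
        map_add' := fun s s' => by
          ext x
          exact (congrArg (ψ x * ·) (map_add (t.localFrameCoeff 𝓘(ℝ, E) b i x) _ _)).trans
            (mul_add _ _ _)
        map_smul' := fun f s => by
          ext x
          exact (congrArg (ψ x * ·) (map_smul (t.localFrameCoeff 𝓘(ℝ, E) b i x) (f x) _)).trans
            (mul_left_comm _ _ _) }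
  let p : SmoothFn E M := ⟨ψ, ψ.contMDiff⟩
  refine ⟨⟨p * p, ?_, e, ε, fun v => ?_⟩⟩
  · filter_upwards [ψ.eventuallyEq_one] with x hx
    change ψ x * ψ x = 1
    simp [hx]
  · ext x
    have hsum : (∑ k, ε k ![v] • e k) x = ∑ k, (ψ x * t.localFrameCoeff 𝓘(ℝ, E) b k x (v x)) •
        (ψ x • t.localFrame b k x) := by
      have : ∀ s : Finset (Fin (Module.finrank ℝ F)), (∑ k ∈ s, ε k ![v] • e k) x =
          ∑ k ∈ s, (ψ x * t.localFrameCoeff 𝓘(ℝ, E) b k x (v x)) • (ψ x • t.localFrame b k x) := by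
        intro s
        induction s using Finset.induction_on with
        | empty => rfl
        | insert k s hk ih => rw [Finset.sum_insert hk, Finset.sum_insert hk, ← ih]; rfl
      exact this _
    rw [hsum]
    change (ψ x * ψ x) • v x = _
    by_cases hx : x ∈ t.baseSet
    · conv_lhs => rw [Bundle.Trivialization.eq_sum_localFrameCoeff_smul (I := 𝓘(ℝ, E)) (b := b)
        (s := fun y => v y) hx]
      rw [Finset.smul_sum]
      refine Finset.sum_congr rfl fun k _ => ?_
      rw [smul_smul, smul_smul]
      congr 1
      ring
    · have h0 : ψ x = 0 := image_eq_zero_of_notMem_tsupport fun h => hx (hsupp h)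
      simp [h0]

/-- A choice of dual frames near `x`. -/
noncomputable def dualFrame (E F : Type*) {M : Type*} (A : M → Type*)
    [NormedAddCommGroup E] [NormedSpace ℝ E] [FiniteDimensional ℝ E]
    [TopologicalSpace M] [ChartedSpace E M] [IsManifold 𝓘(ℝ, E) ∞ M] [T2Space M]
    [NormedAddCommGroup F] [NormedSpace ℝ F] [FiniteDimensional ℝ F]
    [TopologicalSpace (TotalSpace F A)] [∀ x, TopologicalSpace (A x)]
    [∀ x, AddCommGroup (A x)] [∀ x, Module ℝ (A x)]
    [FiberBundle F A] [VectorBundle ℝ F A] [ContMDiffVectorBundle ∞ F A 𝓘(ℝ, E)] (x : M) :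
    DualFrame E F A x :=
  (exists_dualFrame x).some

section Contraction

variable {W : Type*} [AddCommGroup W] [Module (SmoothFn E M) W]

lemma DualFrame.sum_change {x y : M} (P : DualFrame E F A x) (Q : DualFrame E F A y)
    (T : DForm E F A 1 →ₗ[SmoothFn E M] Sec E F A →ₗ[SmoothFn E M] W) :
    P.χ • ∑ k, T (Q.ε k) (Q.e k) = Q.χ • ∑ k, T (P.ε k) (P.e k) := by
  have h1 : ∀ k, P.χ • T (Q.ε k) (Q.e k) = ∑ j, T (P.ε j ![Q.e k] • Q.ε k) (P.e j) := by
    intro k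
    rw [← map_smul, P.sum_eq, map_sum]
    simp
  have h2 : ∀ j, ∑ k, P.ε j ![Q.e k] • Q.ε k = Q.χ • P.ε j := by
    intro j
    ext1 v
    obtain ⟨u, rfl⟩ : ∃ u, v = ![u] := ⟨v 0, by ext i; fin_cases i; rfl⟩
    let g : Sec E F A →ₗ[SmoothFn E M] SmoothFn E M :=
      (AlternatingMap.ofSubsingleton _ _ _ (0 : Fin 1)).symm (P.ε j)
    have hg : ∀ s, P.ε j ![s] = g s := fun s => by
      change _ = P.ε j _
      congr 1; ext i; fin_cases i; rfl
    rw [AlternatingMap.smul_apply, hg, ← map_smul, Q.sum_eq, map_sum]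
    have hs : ∀ s : Finset (Fin (Module.finrank ℝ F)), (∑ k ∈ s, P.ε j ![Q.e k] • Q.ε k) ![u] =
        ∑ k ∈ s, P.ε j ![Q.e k] * Q.ε k ![u] := by
      intro s
      induction s using Finset.induction_on with
      | empty => simp
      | insert k s hk ih => rw [Finset.sum_insert hk, Finset.sum_insert hk, ← ih]; rfl
    rw [hs]
    simp [hg, mul_comm]
  rw [Finset.smul_sum, Finset.smul_sum]
  simp only [h1]
  rw [Finset.sum_comm]
  refine Finset.sum_congr rfl fun j _ => ?_
  rw [← LinearMap.sum_apply, ← map_sum, h2]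
  simp

lemma fn_sum_apply {ι : Type*} (s : Finset ι) (f : ι → SmoothFn E M) (x : M) :
    (∑ k ∈ s, f k) x = ∑ k ∈ s, f k x := by
  classical
  induction s using Finset.induction_on with
  | empty => simp
  | insert k s hk ih => rw [Finset.sum_insert hk, Finset.sum_insert hk, ← ih]; rfl

lemma sec_sum_apply {ι : Type*} (s : Finset ι) (f : ι → Sec E F A) (x : M) :
    (∑ k ∈ s, f k) x = ∑ k ∈ s, f k x := by
  classical
  induction s using Finset.induction_on with
  | empty => rfl
  | insert k s hk ih => rw [Finset.sum_insert hk, Finset.sum_insert hk, ← ih]; rfl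

lemma contr_eq (T : DForm E F A 1 →ₗ[SmoothFn E M] Sec E F A
      →ₗ[SmoothFn E M] SmoothFn E M) {x₀ : M} (P : DualFrame E F A x₀) (x : M) :
    P.χ x * ∑ k, T ((dualFrame E F A x).ε k) ((dualFrame E F A x).e k) x =
      (∑ k, T (P.ε k) (P.e k)) x := by
  have h := congrArg (fun f : SmoothFn E M => f x) (P.sum_change (dualFrame E F A x) T)
  have h1 : (dualFrame E F A x).χ x = 1 := (dualFrame E F A x).χ_eq.self_of_nhds
  rw [← fn_sum_apply]
  refine Eq.trans (b := (dualFrame E F A x).χ x * (∑ k, T (P.ε k) (P.e k)) x) h ?_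
  rw [h1, one_mul]

/-- The trace `T ↦ ∑ T(ε^k, e_k)` over dual local frames of `A*` and `A`. The value at `x` is
computed in dual frames near `x`; by `contr_eq` it does not depend on them. -/
noncomputable def contr : (DForm E F A 1 →ₗ[SmoothFn E M] Sec E F A
      →ₗ[SmoothFn E M] SmoothFn E M) →ₗ[SmoothFn E M] SmoothFn E M where
  toFun T := ⟨fun x => ∑ k, T ((dualFrame E F A x).ε k) ((dualFrame E F A x).e k) x, by
    intro x₀
    let P := dualFrame E F A x₀
    refine ((∑ k, T (P.ε k) (P.e k)).contMDiff x₀).congr_of_eventuallyEq ?_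
    filter_upwards [P.χ_eq] with x hx
    rw [← contr_eq T P x, hx, one_mul]⟩
  map_add' T T' := by
    ext x
    change ∑ k, (T ((dualFrame E F A x).ε k) ((dualFrame E F A x).e k) x +
      T' ((dualFrame E F A x).ε k) ((dualFrame E F A x).e k) x) = _
    rw [Finset.sum_add_distrib]
    rfl
  map_smul' f T := by
    ext x
    change ∑ k, f x * T ((dualFrame E F A x).ε k) ((dualFrame E F A x).e k) x = _
    rw [← Finset.mul_sum]
    rfl

lemma toSec_eq (f : DForm E F A 1 →ₗ[SmoothFn E M] SmoothFn E M) {x₀ : M}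
    (P : DualFrame E F A x₀) (x : M) :
    P.χ x • ∑ k, f ((dualFrame E F A x).ε k) x • (dualFrame E F A x).e k x =
      (∑ k, f (P.ε k) • P.e k) x := by
  have h := congrArg (fun s : Sec E F A => s x) (P.sum_change (dualFrame E F A x)
    ((LinearMap.lsmul (SmoothFn E M) (Sec E F A)).comp f))
  have h1 : (dualFrame E F A x).χ x = 1 := (dualFrame E F A x).χ_eq.self_of_nhds
  have h2 : ∑ k, f ((dualFrame E F A x).ε k) x • (dualFrame E F A x).e k x =
      (∑ k, f ((dualFrame E F A x).ε k) • (dualFrame E F A x).e k) x := by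
    rw [sec_sum_apply]; rfl
  rw [h2]
  refine Eq.trans (b := (dualFrame E F A x).χ x • (∑ k, f (P.ε k) • P.e k) x) h ?_
  rw [h1, one_smul]

/-- The section `X` of `A` such that `⟨β, X⟩ = f(β)`; see `apply_toSec`. -/
noncomputable def toSec : (DForm E F A 1 →ₗ[SmoothFn E M] SmoothFn E M)
    →ₗ[SmoothFn E M] Sec E F A where
  toFun f := ⟨fun x => ∑ k, f ((dualFrame E F A x).ε k) x • (dualFrame E F A x).e k x, by
    intro x₀
    let P := dualFrame E F A x₀
    refine ((∑ k, f (P.ε k) • P.e k).contMDiff x₀).congr_of_eventuallyEq ?_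
    filter_upwards [P.χ_eq] with x hx
    rw [← toSec_eq f P x, hx, one_smul]⟩
  map_add' f g := by
    ext x
    change ∑ k, (f ((dualFrame E F A x).ε k) x + g ((dualFrame E F A x).ε k) x) •
      (dualFrame E F A x).e k x = _
    simp only [add_smul, Finset.sum_add_distrib]
    rfl
  map_smul' c f := by
    ext x
    change ∑ k, (c x * f ((dualFrame E F A x).ε k) x) • (dualFrame E F A x).e k x = _
    simp only [mul_smul, ← Finset.smul_sum]
    rfl

lemma apply_toSec (β : DForm E F A 1)
    (f : DForm E F A 1 →ₗ[SmoothFn E M] SmoothFn E M) :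
    β ![toSec f] = f β := by
  ext x₀
  let P := dualFrame E F A x₀
  have h1 : P.χ • toSec f = ∑ k, f (P.ε k) • P.e k := by
    ext x; exact toSec_eq f P x
  let g : Sec E F A →ₗ[SmoothFn E M] SmoothFn E M :=
    (AlternatingMap.ofSubsingleton _ _ _ (0 : Fin 1)).symm β
  have hg : ∀ s, β ![s] = g s := fun s => by
    change _ = β _
    congr 1; ext i; fin_cases i; rfl
  have h2 : ∑ k, β ![P.e k] • P.ε k = P.χ • β := by
    ext1 v
    obtain ⟨u, rfl⟩ : ∃ u, v = ![u] := ⟨v 0, by ext i; fin_cases i; rfl⟩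
    rw [AlternatingMap.smul_apply, hg, ← map_smul, P.sum_eq, map_sum]
    have hs : ∀ s : Finset (Fin (Module.finrank ℝ F)), (∑ k ∈ s, β ![P.e k] • P.ε k) ![u] =
        ∑ k ∈ s, β ![P.e k] * P.ε k ![u] := by
      intro s
      induction s using Finset.induction_on with
      | empty => simp
      | insert k s hk ih => rw [Finset.sum_insert hk, Finset.sum_insert hk, ← ih]; rfl
    rw [hs]
    simp [hg, mul_comm]
  have h3 : P.χ • β ![toSec f] = P.χ • f β := by
    rw [hg, ← map_smul, h1, map_sum, ← map_smul, ← h2, map_sum]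
    simp [hg, mul_comm]
  have h4 := congrArg (fun f : SmoothFn E M => f x₀) h3
  have h5 : P.χ x₀ = 1 := P.χ_eq.self_of_nhds
  change P.χ x₀ * _ = P.χ x₀ * _ at h4
  rwa [h5, one_mul, one_mul] at h4

/-- Evaluation of `q`-forms on fixed arguments. -/
noncomputable def evalForm {q : ℕ} (v : Fin q → Sec E F A) :
    DForm E F A q →ₗ[SmoothFn E M] SmoothFn E M where
  toFun α := α v
  map_add' _ _ := rfl
  map_smul' _ _ := rfl

/-- The trace `∑ T(ε^k, e_k)` of form-valued maps. -/
noncomputable def contrForm (q : ℕ) :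
    (DForm E F A 1 →ₗ[SmoothFn E M] Sec E F A →ₗ[SmoothFn E M]
      DForm E F A q) →ₗ[SmoothFn E M] DForm E F A q where
  toFun T :=
    { toFun := fun v => contr (T.compr₂ (evalForm v))
      map_update_add' := by
        intro _ v i x y
        rw [← map_add (contr (E := E) (F := F) (A := A))]
        exact congrArg contr (LinearMap.ext₂ fun ε e => (T ε e).map_update_add v i x y)
      map_update_smul' := by
        intro _ v i c x
        rw [← map_smul (contr (E := E) (F := F) (A := A))]
        exact congrArg contr (LinearMap.ext₂ fun ε e => (T ε e).map_update_smul v i c x)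
      map_eq_zero_of_eq' := by
        intro v i j h hij
        rw [← map_zero (contr (E := E) (F := F) (A := A))]
        exact congrArg contr (LinearMap.ext₂ fun ε e => (T ε e).map_eq_zero_of_eq v h hij) }
  map_add' T T' := AlternatingMap.ext fun v =>
    map_add (contr (E := E) (F := F) (A := A)) (T.compr₂ (evalForm v)) (T'.compr₂ (evalForm v))
  map_smul' c T := AlternatingMap.ext fun v =>
    map_smul (contr (E := E) (F := F) (A := A)) c (T.compr₂ (evalForm v))

end Contraction

/-- Interior product `i_P α` of a form with a `p`-vector, with `i_{X ∧ Y} = i_X ∘ i_Y`: it is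
multiplication for `p = 0` and `i_P = (1/(p+1)) ∑ i_{e_k} ∘ i_{P(ε^k, ·)}` for a `(p+1)`-vector `P`. -/
noncomputable def interior : (p m n : ℕ) → (h : m + p = n) →
    MVec E F A p →ₗ[SmoothFn E M]
      DForm E F A n →ₗ[SmoothFn E M] DForm E F A m
  | 0, m, n, h => LinearMap.mk₂ (SmoothFn E M)
      (fun P α => P ![] • α.domDomCongr (finCongr (by omega)))
      (fun _ _ _ => by ext1 v; simp [add_mul]) (fun _ _ _ => by ext1 v; simp [mul_assoc])
      (fun _ _ _ => by ext1 v; simp [mul_add]) (fun _ _ _ => by ext1 v; simp [mul_left_comm])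
  | p + 1, m, n, h => LinearMap.mk₂ (SmoothFn E M)
      (fun P α => ((p + 1 : ℝ)⁻¹) • contrForm m (AlternatingMap.curryLeftLinearMap ∘ₗ
        (interior p (m + 1) n (by omega)).flip α ∘ₗ P.curryLeft))
      (fun P P' α => by
        rw [← smul_add, ← map_add]; congr 2; ext1 ε; simp)
      (fun c P α => by
        rw [smul_comm c ((p + 1 : ℝ)⁻¹), ← map_smul (contrForm m) c]; congr 2; ext1 ε; simp)
      (fun P α α' => by
        rw [← smul_add, ← map_add]; congr 2; ext1 ε; simp)
      (fun c P α => by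
        rw [smul_comm c ((p + 1 : ℝ)⁻¹), ← map_smul (contrForm m) c]; congr 2; ext1 ε; simp)

end Geometry

section Algebra2

variable {R L : Type*} [CommRing R] [Algebra ℝ R] [AddCommGroup L] [Module ℝ L] [Module R L]
  [IsScalarTower ℝ R L]

/-- The pairing `⟨α, v⟩` of a `1`-form with a vector. -/
def linOne : Form R L 1 →ₗ[R] L →ₗ[R] R :=
  LinearMap.mk₂ R (fun α v => α ![v]) (fun _ _ _ => rfl) (fun _ _ _ => rfl)
    (fun α v w => α.toMultilinearMap.cons_add ![] v w)
    (fun c α v => α.toMultilinearMap.cons_smul ![] c v)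

lemma vec_one_eq (v : Fin 1 → L) : v = ![v 0] := by ext i; fin_cases i; rfl

lemma SkewAlgebroid.d_zero_apply (𝒜 : SkewAlgebroid R L) (α : Form R L 0) (v : L) :
    𝒜.d 0 α ![v] = 𝒜.anchor v (α ![]) := by
  change 𝒜.dFun 0 α ![v] = _
  simp [SkewAlgebroid.dFun, SkewAlgebroid.bracketTerm]


lemma SkewAlgebroid.d_one_apply (𝒜 : SkewAlgebroid R L) (α : Form R L 1) (v w : L) :
    𝒜.d 1 α ![v, w] =
      𝒜.anchor v (α ![w]) - 𝒜.anchor w (α ![v]) - α ![𝒜.bracket v w] := by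
  change 𝒜.dFun 1 α ![v, w] = _
  simp [SkewAlgebroid.dFun, SkewAlgebroid.bracketTerm, Fin.sum_univ_two]
  have h : (1 : Fin 2).removeNth (![v, w] : Fin 2 → L) = ![v] := by
    ext i; fin_cases i; simp [Fin.removeNth_apply]
  rw [h]
  ring

lemma SkewAlgebroid.lieDeriv_one_apply (𝒜 : SkewAlgebroid R L) (X : L) (α : Form R L 1) (v : L) :
    𝒜.lieDeriv X 1 α ![v] = 𝒜.anchor X (α ![v]) - α ![𝒜.bracket X v] := by
  change 𝒜.d 1 α ![X, v] + 𝒜.d 0 (iota X α) ![v] = _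
  rw [d_one_apply, d_zero_apply]
  change _ + 𝒜.anchor v (α ![X]) = _
  ring

lemma SkewAlgebroid.lieDeriv_one_smul_left (𝒜 : SkewAlgebroid R L) (f : R) (X : L)
    (α : Form R L 1) :
    𝒜.lieDeriv (f • X) 1 α = f • 𝒜.lieDeriv X 1 α + α ![X] • 𝒜.d 0 (fnForm f) := by
  ext v
  obtain ⟨u, rfl⟩ : ∃ u, v = ![u] := ⟨v 0, vec_one_eq v⟩
  have h1 : α ![𝒜.bracket (f • X) u] = f * α ![𝒜.bracket X u] - 𝒜.anchor u f * α ![X] := by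
    rw [𝒜.leibniz_left]
    change linOne α _ = f * linOne α _ - _ * linOne α _
    simp
  simp only [AlternatingMap.add_apply, AlternatingMap.smul_apply, lieDeriv_one_apply,
    d_zero_apply, h1, map_smul, smul_eq_mul, Derivation.smul_apply]
  change _ = _ + α ![X] * 𝒜.anchor u f
  ring

lemma SkewAlgebroid.lieDeriv_one_smul_right (𝒜 : SkewAlgebroid R L) (f : R) (X : L)
    (α : Form R L 1) :
    𝒜.lieDeriv X 1 (f • α) = f • 𝒜.lieDeriv X 1 α + 𝒜.anchor X f • α := by
  ext v
  obtain ⟨u, rfl⟩ : ∃ u, v = ![u] := ⟨v 0, vec_one_eq v⟩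
  simp only [AlternatingMap.add_apply, AlternatingMap.smul_apply, lieDeriv_one_apply,
    smul_eq_mul, Derivation.leibniz]
  ring

lemma SkewAlgebroid.d_fnForm_mul (𝒜 : SkewAlgebroid R L) (f g : R) :
    𝒜.d 0 (fnForm (f * g)) = f • 𝒜.d 0 (fnForm g) + g • 𝒜.d 0 (fnForm f) := by
  ext v
  obtain ⟨u, rfl⟩ : ∃ u, v = ![u] := ⟨v 0, vec_one_eq v⟩
  simp only [AlternatingMap.add_apply, AlternatingMap.smul_apply, d_zero_apply]
  change 𝒜.anchor u (f * g) = f • 𝒜.anchor u g + g • 𝒜.anchor u f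
  simp

/-- The Lie derivation of `1`-forms, as a bilinear map. -/
noncomputable def SkewAlgebroid.lieDerivOne (𝒜 : SkewAlgebroid R L) :
    L →ₗ[ℝ] Form R L 1 →ₗ[ℝ] Form R L 1 :=
  LinearMap.mk₂ ℝ (fun X α => 𝒜.lieDeriv X 1 α)
    (fun X Y α => by
      ext v
      obtain ⟨u, rfl⟩ : ∃ u, v = ![u] := ⟨v 0, vec_one_eq v⟩
      have h1 : α ![𝒜.bracket (X + Y) u] = α ![𝒜.bracket X u] + α ![𝒜.bracket Y u] := by
        change linOne α _ = linOne α _ + linOne α _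
        simp
      simp only [AlternatingMap.add_apply, lieDeriv_one_apply]
      rw [h1, map_add, Derivation.add_apply]
      ring)
    (fun c X α => by
      rw [← algebraMap_smul R c X, lieDeriv_one_smul_left]
      have h : 𝒜.d 0 (fnForm (algebraMap ℝ R c)) = 0 := by
        ext v
        obtain ⟨u, rfl⟩ : ∃ u, v = ![u] := ⟨v 0, vec_one_eq v⟩
        rw [d_zero_apply]
        exact (𝒜.anchor u).map_algebraMap c
      rw [h, smul_zero, add_zero, algebraMap_smul])
    (fun X α β => by
      ext v
      obtain ⟨u, rfl⟩ : ∃ u, v = ![u] := ⟨v 0, vec_one_eq v⟩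
      simp only [AlternatingMap.add_apply, lieDeriv_one_apply, map_add]
      ring)
    (fun c X α => by
      ext v
      obtain ⟨u, rfl⟩ : ∃ u, v = ![u] := ⟨v 0, vec_one_eq v⟩
      simp only [AlternatingMap.smul_apply, lieDeriv_one_apply, Derivation.map_smul, smul_sub])

/-- Cycles modulo boundaries. -/
def CycleQuotient {V : Type*} [AddCommGroup V] [Module ℝ V] (Z B : Submodule ℝ V) : Type _ :=
  Z ⧸ B.submoduleOf Z

instance {V : Type*} [AddCommGroup V] [Module ℝ V] (Z B : Submodule ℝ V) :
    AddCommGroup (CycleQuotient Z B) :=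
  inferInstanceAs (AddCommGroup (Z ⧸ B.submoduleOf Z))

instance {V : Type*} [AddCommGroup V] [Module ℝ V] (Z B : Submodule ℝ V) :
    Module ℝ (CycleQuotient Z B) :=
  inferInstanceAs (Module ℝ (Z ⧸ B.submoduleOf Z))

/-- The class of a cycle. -/
def cycleClass {V : Type*} [AddCommGroup V] [Module ℝ V] (Z B : Submodule ℝ V) :
    Z →ₗ[ℝ] CycleQuotient Z B :=
  (B.submoduleOf Z).mkQ

end Algebra2

section Geometry2

variable {E M F : Type*} {A : M → Type*}
  [NormedAddCommGroup E] [NormedSpace ℝ E] [FiniteDimensional ℝ E]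
  [TopologicalSpace M] [ChartedSpace E M] [IsManifold 𝓘(ℝ, E) ∞ M] [T2Space M]
  [NormedAddCommGroup F] [NormedSpace ℝ F] [FiniteDimensional ℝ F]
  [TopologicalSpace (TotalSpace F A)] [∀ x, TopologicalSpace (A x)]
  [∀ x, AddCommGroup (A x)] [∀ x, Module ℝ (A x)]
  [FiberBundle F A] [VectorBundle ℝ F A] [ContMDiffVectorBundle ∞ F A 𝓘(ℝ, E)]

/-- `π♯ : A* → A`, with `⟨β, π♯ α⟩ = π(α, β)`; see `apply_sharp`. -/
noncomputable def sharp (π : MVec E F A 2) : DForm E F A 1 →ₗ[SmoothFn E M] Sec E F A :=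
  toSec ∘ₗ linOne ∘ₗ π.curryLeft

lemma apply_sharp (π : MVec E F A 2) (α β : DForm E F A 1) : β ![sharp π α] = π ![α, β] :=
  apply_toSec β _

/-- The `A*`-valued bivector `ψ⁽²⁾(α, β) = ψ(π♯α, π♯β, ·)`. -/
noncomputable def psi2 (π : MVec E F A 2) (ψ : DForm E F A 3) :
    DForm E F A 1 →ₗ[SmoothFn E M] DForm E F A 1 →ₗ[SmoothFn E M] DForm E F A 1 :=
  (AlternatingMap.curryLeftLinearMap ∘ₗ ψ.curryLeft ∘ₗ sharp π).compl₂ (sharp π)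

lemma psi2_apply (π : MVec E F A 2) (ψ : DForm E F A 3) (α β : DForm E F A 1) (v : Sec E F A) :
    psi2 π ψ α β ![v] = ψ ![sharp π α, sharp π β, v] := rfl

/-- For a section `v` of `A`, the bivector `⟨ψ⁽²⁾, v⟩ : (α, β) ↦ ψ(π♯α, π♯β, v)`. -/
noncomputable def psi2Bivector (π : MVec E F A 2) (ψ : DForm E F A 3) :
    Sec E F A →ₗ[SmoothFn E M] MVec E F A 2 where
  toFun v := (ψ.curryLeft v).compLinearMap (sharp π)
  map_add' v w := by ext1; simp
  map_smul' c v := by ext1; simp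

lemma psi2Bivector_apply (π : MVec E F A 2) (ψ : DForm E F A 3) (v : Sec E F A)
    (α β : DForm E F A 1) :
    psi2Bivector π ψ v ![α, β] = ψ ![sharp π α, sharp π β, v] := by
  have h : psi2Bivector π ψ v ![α, β] = ψ ![v, sharp π α, sharp π β] := by
    change ψ _ = ψ _
    congr 1; ext i; fin_cases i <;> rfl
  have h1 : (![v, sharp π α, sharp π β] : Fin 3 → Sec E F A) =
      (![sharp π α, sharp π β, v] ∘ Equiv.swap 1 2) ∘ Equiv.swap 0 1 := by
    ext i; fin_cases i <;> rfl
  rw [h, h1, ψ.map_swap _ (by decide), ψ.map_swap _ (by decide), neg_neg]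

/-- The section `Y_{π,ψ}`: `⟨α, Y⟩` is one half of the trace of `β ↦ ψ⁽²⁾(α, β)`. -/
noncomputable def ySection (π : MVec E F A 2) (ψ : DForm E F A 3) : Sec E F A :=
  toSec ((1 / 2 : ℝ) • contr ∘ₗ (psi2 π ψ).compr₂ linOne)

/-- The operator `underline∂_{π,ψ} = i_{ψ⁽²⁾}`, where `i_{ξ ⊗ Q} α = ξ ∧ i_Q α` for a form `ξ` and a
bivector `Q`: the antisymmetrization of `v, v_1, …, v_q ↦ (i_{⟨ψ⁽²⁾, v⟩} α)(v_1, …, v_q)`. -/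
noncomputable def underBd (π : MVec E F A 2) (ψ : DForm E F A 3) :
    (q : ℕ) → DForm E F A (q + 1) →ₗ[SmoothFn E M] DForm E F A q
  | 0 => 0
  | q + 1 =>
    { toFun := fun α => AlternatingMap.alternatizeUncurryFin
        ((interior 2 q (q + 2) rfl).flip α ∘ₗ psi2Bivector π ψ)
      map_add' := fun α β => by
        rw [map_add, LinearMap.add_comp, AlternatingMap.alternatizeUncurryFin_add]
      map_smul' := fun c α => by
        rw [map_smul, LinearMap.smul_comp, AlternatingMap.alternatizeUncurryFin_smul]; rfl }

/-- `∂_π = [d, i_π] = d i_π - i_π d`, from `(q+1)`-forms to `q`-forms (`i_π` vanishes on `1`-forms). -/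
noncomputable def SkewAlgebroid.bdPi (𝒜 : SkewAlgebroid (SmoothFn E M) (Sec E F A))
    (π : MVec E F A 2) : (q : ℕ) → DForm E F A (q + 1) →ₗ[ℝ] DForm E F A q
  | 0 => -((interior 2 0 2 rfl π).restrictScalars ℝ ∘ₗ 𝒜.d 1)
  | q + 1 => 𝒜.d q ∘ₗ (interior 2 q (q + 2) rfl π).restrictScalars ℝ -
      (interior 2 (q + 1) (q + 3) rfl π).restrictScalars ℝ ∘ₗ 𝒜.d (q + 2)

/-- `[α, β]_{π,ψ} = L_{π♯α} β - L_{π♯β} α - d(π(α, β)) + ψ⁽²⁾(α, β)`. -/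
noncomputable def SkewAlgebroid.dualBracket (𝒜 : SkewAlgebroid (SmoothFn E M) (Sec E F A))
    (π : MVec E F A 2) (ψ : DForm E F A 3) (α β : DForm E F A 1) : DForm E F A 1 :=
  𝒜.lieDeriv (sharp π α) 1 β - 𝒜.lieDeriv (sharp π β) 1 α - 𝒜.d 0 (fnForm (π ![α, β])) +
    psi2 π ψ α β

/-- The bracket `[α, β]_{π,ψ}`, as an `ℝ`-bilinear map. -/
noncomputable def SkewAlgebroid.dualBracketBilin
    (𝒜 : SkewAlgebroid (SmoothFn E M) (Sec E F A))
    (π : MVec E F A 2) (ψ : DForm E F A 3) :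
    DForm E F A 1 →ₗ[ℝ] DForm E F A 1 →ₗ[ℝ] DForm E F A 1 :=
  LinearMap.mk₂ ℝ (𝒜.dualBracket π ψ)
    (fun α α' β => by
      have h : π ![α + α', β] = π ![α, β] + π ![α', β] :=
        π.toMultilinearMap.cons_add ![β] α α'
      have hd : ∀ f g : SmoothFn E M, 𝒜.d 0 (fnForm (f + g)) =
        𝒜.d 0 (fnForm f) + 𝒜.d 0 (fnForm g) := fun f g => map_add (𝒜.d 0) (fnForm f) (fnForm g)
      have h1 := LinearMap.congr_fun (𝒜.lieDerivOne.map_add (sharp π α) (sharp π α')) β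
      have h2 := (𝒜.lieDerivOne (sharp π β)).map_add α α'
      simp only [SkewAlgebroid.lieDerivOne, LinearMap.mk₂_apply, LinearMap.add_apply] at h1 h2
      simp only [SkewAlgebroid.dualBracket, h, hd, map_add, LinearMap.add_apply, h1, h2]
      abel)
    (fun c α β => by
      have h : π ![c • α, β] = c • π ![α, β] := by
        rw [← algebraMap_smul (SmoothFn E M) c α, ← algebraMap_smul (SmoothFn E M) c]
        exact π.toMultilinearMap.cons_smul ![β] _ α
      have hd : ∀ f : SmoothFn E M, 𝒜.d 0 (fnForm (c • f)) = c • 𝒜.d 0 (fnForm f) :=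
        fun f => map_smul (𝒜.d 0) c (fnForm f)
      have hs : sharp π (c • α) = c • sharp π α := ((sharp π).restrictScalars ℝ).map_smul c α
      have hp : psi2 π ψ (c • α) β = c • psi2 π ψ α β :=
        LinearMap.congr_fun (((psi2 π ψ).restrictScalars ℝ).map_smul c α) β
      have h1 := LinearMap.congr_fun (𝒜.lieDerivOne.map_smul c (sharp π α)) β
      have h2 := (𝒜.lieDerivOne (sharp π β)).map_smul c α
      simp only [SkewAlgebroid.lieDerivOne, LinearMap.mk₂_apply, LinearMap.smul_apply] at h1 h2
      simp only [SkewAlgebroid.dualBracket, h, hd, hs, hp, h1, h2, smul_add, smul_sub])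
    (fun α β β' => by
      have h : π ![α, β + β'] = π ![α, β] + π ![α, β'] :=
        (π.curryLeft α).toMultilinearMap.cons_add ![] β β'
      have hd : ∀ f g : SmoothFn E M, 𝒜.d 0 (fnForm (f + g)) =
        𝒜.d 0 (fnForm f) + 𝒜.d 0 (fnForm g) := fun f g => map_add (𝒜.d 0) (fnForm f) (fnForm g)
      have h1 := LinearMap.congr_fun (𝒜.lieDerivOne.map_add (sharp π β) (sharp π β')) α
      have h2 := (𝒜.lieDerivOne (sharp π α)).map_add β β'
      simp only [SkewAlgebroid.lieDerivOne, LinearMap.mk₂_apply, LinearMap.add_apply] at h1 h2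
      simp only [SkewAlgebroid.dualBracket, h, hd, map_add, LinearMap.add_apply, h1, h2]
      abel)
    (fun c α β => by
      have h : π ![α, c • β] = c • π ![α, β] := by
        rw [← algebraMap_smul (SmoothFn E M) c β, ← algebraMap_smul (SmoothFn E M) c]
        exact (π.curryLeft α).toMultilinearMap.cons_smul ![] _ β
      have hd : ∀ f : SmoothFn E M, 𝒜.d 0 (fnForm (c • f)) = c • 𝒜.d 0 (fnForm f) :=
        fun f => map_smul (𝒜.d 0) c (fnForm f)
      have hs : sharp π (c • β) = c • sharp π β := ((sharp π).restrictScalars ℝ).map_smul c β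
      have hp : psi2 π ψ α (c • β) = c • psi2 π ψ α β :=
        ((psi2 π ψ α).restrictScalars ℝ).map_smul c β
      have h1 := LinearMap.congr_fun (𝒜.lieDerivOne.map_smul c (sharp π β)) α
      have h2 := (𝒜.lieDerivOne (sharp π α)).map_smul c β
      simp only [SkewAlgebroid.lieDerivOne, LinearMap.mk₂_apply, LinearMap.smul_apply] at h1 h2
      simp only [SkewAlgebroid.dualBracket, h, hd, hs, hp, h1, h2, smul_add, smul_sub])

/-- The bracket `[α, β]_{π,ψ}` and the anchor `ρ ∘ π♯` on the sections of `A*`. -/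
noncomputable def dualAlgebroid (𝒜 : SkewAlgebroid (SmoothFn E M) (Sec E F A))
    (π : MVec E F A 2) (ψ : DForm E F A 3) : SkewAlgebroid (SmoothFn E M) (DForm E F A 1) where
  anchor := 𝒜.anchor ∘ₗ sharp π
  bracket := 𝒜.dualBracketBilin π ψ
  bracket_self α := by
    have h : π ![α, α] = 0 := π.map_eq_zero_of_eq ![α, α] (i := 0) (j := 1) rfl (by decide)
    have h' : psi2 π ψ α α = 0 := by
      ext1 v
      exact ψ.map_eq_zero_of_eq _ (i := 0) (j := 1) rfl (by decide)
    have hd : 𝒜.d 0 (fnForm 0) = 0 := map_zero (𝒜.d 0)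
    change 𝒜.dualBracket π ψ α α = 0
    simp [SkewAlgebroid.dualBracket, h, h', hd]
  leibniz α β f := by
    change 𝒜.dualBracket π ψ α (f • β) =
      f • 𝒜.dualBracket π ψ α β + 𝒜.anchor (sharp π α) f • β
    have h : π ![α, f • β] = f * π ![α, β] :=
      (π.curryLeft α).toMultilinearMap.cons_smul ![] f β
    have h1 : α ![sharp π β] = -π ![α, β] := by
      rw [apply_sharp]
      have : (![β, α] : Fin 2 → DForm E F A 1) = ![α, β] ∘ Equiv.swap 0 1 := by
        ext1 i; fin_cases i <;> rfl
      rw [this, π.map_swap _ (by decide)]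
    have hn : (-π ![α, β]) • 𝒜.d 0 (fnForm f) = -(π ![α, β] • 𝒜.d 0 (fnForm f)) := by
      ext1 v
      change (-π ![α, β]) * _ = -(π ![α, β] * _)
      ring
    simp only [SkewAlgebroid.dualBracket, map_smul, 𝒜.lieDeriv_one_smul_left,
      𝒜.lieDeriv_one_smul_right, h, 𝒜.d_fnForm_mul, h1, hn, smul_add, smul_sub]
    abel

/-- The operator `∂_π + underline∂_{π,ψ} + i_Y`. -/
noncomputable def SkewAlgebroid.bd (𝒜 : SkewAlgebroid (SmoothFn E M) (Sec E F A))
    (π : MVec E F A 2) (ψ : DForm E F A 3) (q : ℕ) : DForm E F A (q + 1) →ₗ[ℝ] DForm E F A q :=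
  𝒜.bdPi π q + (underBd π ψ q).restrictScalars ℝ +
    ((AlternatingMap.curryLeftLinearMap.flip (ySection π ψ)).restrictScalars ℝ :
      DForm E F A (q + 1) →ₗ[ℝ] DForm E F A q)

/-- A section `Z` of `A`, as a `1`-vector `α ↦ ⟨α, Z⟩`. -/
noncomputable def vecMV (Z : Sec E F A) : MVec E F A 1 :=
  AlternatingMap.ofSubsingleton (SmoothFn E M) (DForm E F A 1) (SmoothFn E M) (0 : Fin 1)
    (linOne.flip Z)

/-- The decomposable `p`-vector `X₁ ∧ ⋯ ∧ X_p`, with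
`(X₁ ∧ ⋯ ∧ X_p)(α₁, …, α_p) = det ⟨α_i, X_j⟩`. -/
noncomputable def wedge {p : ℕ} (X : Fin p → Sec E F A) : MVec E F A p :=
  (Matrix.detRowAlternating (n := Fin p) (R := SmoothFn E M)).compLinearMap
    (LinearMap.pi fun j => linOne.flip (X j))

/-- The Schouten-Nijenhuis bracket of decomposable bivectors,
`[a ∧ b, c ∧ d] = [a,c] ∧ b ∧ d - [a,d] ∧ b ∧ c - [b,c] ∧ a ∧ d + [b,d] ∧ a ∧ c`. -/
noncomputable def LieAlgebroid.schoutenDecomp (𝔄 : LieAlgebroid E F A) (a b c d : Sec E F A) :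
    MVec E F A 3 :=
  wedge ![𝔄.bracket a c, b, d] - wedge ![𝔄.bracket a d, b, c] -
    wedge ![𝔄.bracket b c, a, d] + wedge ![𝔄.bracket b d, a, c]

/-- `T` is the Schouten-Nijenhuis square `[π, π]`: near every point `x`, write
`π = ∑ i, a_i ∧ b_i`; then `T = ∑ i j, [a_i ∧ b_i, a_j ∧ b_j]` at `x`. (Every bivector has such
local decompositions, and the value at `x` does not depend on the decomposition.) -/
def LieAlgebroid.IsSchoutenSquare (𝔄 : LieAlgebroid E F A) (π : MVec E F A 2)
    (T : MVec E F A 3) : Prop :=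
  ∀ x : M, ∃ (n : ℕ) (a b : Fin n → Sec E F A),
    (∀ᶠ y in 𝓝 x, ∀ α : Fin 2 → DForm E F A 1, π α y = (∑ i, wedge ![a i, b i]) α y) ∧
    ∀ α : Fin 3 → DForm E F A 1,
      T α x = (∑ i, ∑ j, 𝔄.schoutenDecomp (a i) (b i) (a j) (b j)) α x

/-- The trivector `(∧³ π♯) ψ`, that is the image of the form `ψ` under the exterior power of
`π♯ : A* → A`. Since `⟨α, π♯ β⟩ = -⟨β, π♯ α⟩`, its value on `(α, β, γ)` is
`(-1)³ ψ(π♯α, π♯β, π♯γ)`. -/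
noncomputable def sharp3 (π : MVec E F A 2) (ψ : DForm E F A 3) : MVec E F A 3 :=
  -(ψ.compLinearMap (sharp π))

/-- `(π, ψ)` is a twisted Poisson structure on the Lie algebroid: `d_A ψ = 0` and
`½ [π, π] = (∧³ π♯) ψ`. -/
structure LieAlgebroid.IsTwistedPoisson (𝔄 : LieAlgebroid E F A) (π : MVec E F A 2)
    (ψ : DForm E F A 3) : Prop where
  closed : 𝔄.toSkew.d 3 ψ = 0
  schouten : ∃ T : MVec E F A 3, 𝔄.IsSchoutenSquare π T ∧ (1 / 2 : ℝ) • T = sharp3 π ψ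

/-- The differential `d_{π,ψ}` of the Lie algebroid `A*`, on `Γ(∧ᵖ A)`. -/
noncomputable def LieAlgebroid.dPiPsi (𝔄 : LieAlgebroid E F A) (π : MVec E F A 2)
    (ψ : DForm E F A 3) (p : ℕ) : MVec E F A p →ₗ[ℝ] MVec E F A (p + 1) :=
  (dualAlgebroid 𝔄.toSkew π ψ).d p

/-- The hamiltonian section `H_g = π♯ (d_A g)`. -/
noncomputable def LieAlgebroid.hamiltonian (𝔄 : LieAlgebroid E F A) (π : MVec E F A 2)
    (g : SmoothFn E M) : Sec E F A :=
  sharp π (𝔄.toSkew.d 0 (fnForm g))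

/-- `lam` is a nowhere-vanishing form of top degree. -/
def IsVolumeForm (lam : DForm E F A (Module.finrank ℝ F)) : Prop :=
  ∀ x : M, ∃ v : Fin (Module.finrank ℝ F) → Sec E F A, lam v x ≠ 0

/-- `X` is the section `X_{π,λ}`, determined by
`⟨α, X⟩ λ = L_{π♯α} λ - (i_π d_A α) λ` for all `1`-forms `α`. -/
def LieAlgebroid.IsModularX (𝔄 : LieAlgebroid E F A) (π : MVec E F A 2)
    (lam : DForm E F A (Module.finrank ℝ F)) (X : Sec E F A) : Prop :=
  ∀ α : DForm E F A 1, α ![X] • lam =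
    𝔄.toSkew.lieDeriv (sharp π α) (Module.finrank ℝ F) lam -
      interior 2 0 2 rfl π (𝔄.toSkew.d 1 α) ![] • lam

/-- `Z` is the modular section `Z_{π,ψ,λ} = X_{π,λ} + Y_{π,ψ}`. -/
def LieAlgebroid.IsModularSection (𝔄 : LieAlgebroid E F A) (π : MVec E F A 2)
    (ψ : DForm E F A 3) (lam : DForm E F A (Module.finrank ℝ F)) (Z : Sec E F A) : Prop :=
  ∃ X : Sec E F A, 𝔄.IsModularX π lam X ∧ Z = X + ySection π ψ

/-- The modular class vanishes: the modular section is a `d_{π,ψ}`-coboundary. -/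
def LieAlgebroid.IsUnimodular (𝔄 : LieAlgebroid E F A) (π : MVec E F A 2)
    (ψ : DForm E F A 3) (lam : DForm E F A (Module.finrank ℝ F)) : Prop :=
  ∃ (Z : Sec E F A) (g : SmoothFn E M), 𝔄.IsModularSection π ψ lam Z ∧
    vecMV Z = 𝔄.dPiPsi π ψ 0 (fnForm g)

/-- The operator `∂_π + underline∂_{π,ψ} + i_Y` from `(k+1)`-forms to `k`-forms. -/
noncomputable def LieAlgebroid.bd (𝔄 : LieAlgebroid E F A) (π : MVec E F A 2)
    (ψ : DForm E F A 3) (k : ℕ) : DForm E F A (k + 1) →ₗ[ℝ] DForm E F A k :=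
  𝔄.toSkew.bd π ψ k

/-- `k`-cycles of `∂_π + underline∂_{π,ψ} + i_Y`. -/
noncomputable def LieAlgebroid.cycles (𝔄 : LieAlgebroid E F A) (π : MVec E F A 2)
    (ψ : DForm E F A 3) : (k : ℕ) → Submodule ℝ (DForm E F A k)
  | 0 => ⊤
  | k + 1 => LinearMap.ker (𝔄.bd π ψ k)

/-- `k`-boundaries of `∂_π + underline∂_{π,ψ} + i_Y`. -/
noncomputable def LieAlgebroid.boundaries (𝔄 : LieAlgebroid E F A) (π : MVec E F A 2)
    (ψ : DForm E F A 3) (k : ℕ) : Submodule ℝ (DForm E F A k) :=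
  LinearMap.range (𝔄.bd π ψ k)

/-- The homology `H_k^{π,ψ}(A)`. -/
abbrev LieAlgebroid.Homology (𝔄 : LieAlgebroid E F A) (π : MVec E F A 2)
    (ψ : DForm E F A 3) (k : ℕ) : Type _ :=
  CycleQuotient (𝔄.cycles π ψ k) (𝔄.boundaries π ψ k)

/-- The homology class of a cycle. -/
noncomputable def LieAlgebroid.homologyClass (𝔄 : LieAlgebroid E F A) (π : MVec E F A 2)
    (ψ : DForm E F A 3) (k : ℕ) : 𝔄.cycles π ψ k →ₗ[ℝ] 𝔄.Homology π ψ k :=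
  cycleClass _ _

/-- `p`-cocycles of `d_{π,ψ}`. -/
noncomputable def LieAlgebroid.cocycles (𝔄 : LieAlgebroid E F A) (π : MVec E F A 2)
    (ψ : DForm E F A 3) (p : ℕ) : Submodule ℝ (MVec E F A p) :=
  LinearMap.ker (𝔄.dPiPsi π ψ p)

/-- `p`-coboundaries of `d_{π,ψ}`. -/
noncomputable def LieAlgebroid.coboundaries (𝔄 : LieAlgebroid E F A) (π : MVec E F A 2)
    (ψ : DForm E F A 3) : (p : ℕ) → Submodule ℝ (MVec E F A p)
  | 0 => ⊥
  | p + 1 => LinearMap.range (𝔄.dPiPsi π ψ p)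

/-- The cohomology `H^p_{π,ψ}(A*)`. -/
abbrev LieAlgebroid.Cohomology (𝔄 : LieAlgebroid E F A) (π : MVec E F A 2)
    (ψ : DForm E F A 3) (p : ℕ) : Type _ :=
  CycleQuotient (𝔄.cocycles π ψ p) (𝔄.coboundaries π ψ p)

/-- The cohomology class of a cocycle. -/
noncomputable def LieAlgebroid.cohomologyClass (𝔄 : LieAlgebroid E F A) (π : MVec E F A 2)
    (ψ : DForm E F A 3) (p : ℕ) : 𝔄.cocycles π ψ p →ₗ[ℝ] 𝔄.Cohomology π ψ p :=
  cycleClass _ _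

/-- `*_μ : Γ(∧ᵖ A) → Γ(∧ᵏ A*)`, `V ↦ i_V μ`, for a form `μ` of top degree `k + p`. -/
noncomputable def hodgeStar (μ : DForm E F A (Module.finrank ℝ F)) (p k : ℕ)
    (h : k + p = Module.finrank ℝ F) : MVec E F A p →ₗ[SmoothFn E M] DForm E F A k :=
  (interior p k (Module.finrank ℝ F) h).flip μ

end Geometry2

end TwistedPoisson

/-! Let `D = ∂_π + underline∂_{π,ψ} + i_Y`, let `e_α` be the exterior product with a 1-form `α`, and
let `μ` be a nowhere vanishing form of top degree `N`. The bracket of `A*` is a derived bracket of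
`D`: the graded commutator `[[D, e_α], e_β]` equals `-e_{[α,β]_{π,ψ}}` (`dualLieG_eG`). The star of
`μ` turns contraction by `α` into `e_α`, that is `α ∧ *V = *(i_α V)`, because `α ∧ μ = 0`
(`eG_IV_single`). Suppose also `Dμ = 0`. Then `[D, e_α]` corresponds under the star to minus the Lie
derivative of the algebroid `A*`: the two agree on functions and have the same commutators with
every `e_β` (`dualLieG_IV_single`). Cartan's formula for `A*` and induction on the degree of `V`
then give `D *V = -* d_{π,ψ} V` (`bdG_IV_single`).

The condition `Dμ = 0` is where unimodularity enters. The exterior product of `Dμ` with `α` is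
computed term by term: `∂_π` gives `(i_π dα)μ - L_{π♯α}μ`, `underline∂` gives `-2⟨α,Y⟩μ` and `i_Y`
gives `⟨α,Y⟩μ`. The sum is `-⟨α, Z_μ⟩μ`, so `Dμ` vanishes when the modular section of `μ` does
(`bdG_single_eq_zero`). Replacing `λ` by `e^g λ` changes the modular section from `Z_λ` to `Z_λ -
H_g`, so `μ = e^g λ` qualifies when `Z_λ = H_g` (`bdG_single_exp_smul`).

Two detection principles reduce everything to algebra. An operator on inhomogeneous forms that
commutes up to a constant with all contractions and has no component in degree 0 is zero
(`end_eq_zero`); it yields the commutation rules not read off directly in components. A form of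
degree below `N` that is killed by all `e_α`, or any form of degree above `N`, is zero
(`graded_eq_zero_of_eG`); it yields the statements about `μ`, and the surjectivity of the star. Once
the star is bijective and intertwines the differentials up to sign, it matches cycles with cocycles
and boundaries with coboundaries. -/

namespace TwistedPoisson

/-! ### Contractions and Lie derivatives in components -/

section GradedAlgebra

variable {R L : Type*} [CommRing R] [Algebra ℝ R] [AddCommGroup L] [Module ℝ L] [Module R L]
  [IsScalarTower ℝ R L]

lemma iota_apply {q : ℕ} (X : L) (α : Form R L (q + 1)) (v : Fin q → L) :
    iota X α v = α (Matrix.vecCons X v) := rfl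

/-- A form of positive degree all of whose contractions vanish is zero. -/
lemma form_ext_iota {q : ℕ} {α β : Form R L (q + 1)} (h : ∀ X, iota X α = iota X β) : α = β := by
  ext v
  rw [← Matrix.cons_head_tail v]
  exact DFunLike.congr_fun (h (Matrix.vecHead v)) (Matrix.vecTail v)

lemma form_zero_eq_fnForm (α : Form R L 0) : α = fnForm (α ![]) := by
  ext v
  rw [Subsingleton.elim v ![]]
  rfl

lemma iota_iota_swap {q : ℕ} (X Y : L) (α : Form R L (q + 2)) :
    iota X (iota Y α) = -iota Y (iota X α) := by
  ext v
  simp only [iota_apply, AlternatingMap.neg_apply]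
  have : (Matrix.vecCons Y (Matrix.vecCons X v) : Fin (q + 2) → L) =
      Matrix.vecCons X (Matrix.vecCons Y v) ∘ Equiv.swap 0 1 := by
    ext i
    refine Fin.cases (by simp) (fun i => Fin.cases (by simp) (fun i => ?_) i) i
    rw [Function.comp_apply, Equiv.swap_apply_of_ne_of_ne (Fin.succ_ne_zero _)
      (by rw [← Fin.succ_zero_eq_one, Ne, Fin.succ_inj]; exact Fin.succ_ne_zero i)]
    simp
  rw [this, α.map_swap _ (by simp)]

/-- Contraction in the first slot commutes with the antisymmetrization of a linear family of forms
up to sign and the value of the family. -/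
lemma iota_alternatize_zero (T : L →ₗ[R] Form R L 0) (X : L) :
    iota X (AlternatingMap.alternatizeUncurryFin T) = T X := by
  ext v
  rw [iota_apply, AlternatingMap.alternatizeUncurryFin_apply]
  simp [SkewAlgebroid.removeNth_zero_cons]

/-- Split the alternating sum by the slot that feeds `T`: slot 0 contributes `T X`, and in the other
slots `X` is an argument of the form, with all signs shifted by one. -/
lemma iota_alternatize_succ {q : ℕ} (T : L →ₗ[R] Form R L (q + 1)) (X : L) :
    iota X (AlternatingMap.alternatizeUncurryFin T) =
      T X - AlternatingMap.alternatizeUncurryFin (AlternatingMap.curryLeftLinearMap.flip X ∘ₗ T) := by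
  ext v
  rw [iota_apply, AlternatingMap.alternatizeUncurryFin_apply, AlternatingMap.sub_apply,
    AlternatingMap.alternatizeUncurryFin_apply, Fin.sum_univ_succ]
  simp only [Fin.val_zero, pow_zero, one_smul, Matrix.cons_val_zero, SkewAlgebroid.removeNth_zero_cons,
    Matrix.cons_val_succ, SkewAlgebroid.removeNth_succ_cons, Fin.val_succ, pow_succ, mul_neg_one, neg_smul,
    Finset.sum_neg_distrib, ← sub_eq_add_neg]
  rfl

namespace SkewAlgebroid

variable (𝒜 : SkewAlgebroid R L)

/-- The pairs with first index 0 bracket `X` with an entry of `w`. In all other pairs `X` stands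
just behind the bracket, and exchanging the two produces the minus sign. -/
lemma bracketTerm_cons (q : ℕ) (α : Form R L (q + 2)) (X : L) (w : Fin (q + 2) → L) :
    𝒜.bracketTerm (q + 2) α (Matrix.vecCons X w) =
      (∑ l : Fin (q + 2), (-1 : ℤ) ^ ((l : ℕ) + 1) •
        α (Matrix.vecCons (𝒜.bracket X (w l)) (l.removeNth w))) -
      𝒜.bracketTerm (q + 1) (iota X α) w := by
  have hIci : ∀ {n : ℕ} (k : Fin n) (g : Fin n → R),
      ∑ l ≥ k, g l = ∑ l, if k ≤ l then g l else 0 := by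
    intro n k g
    rw [← Finset.sum_filter]
    congr 1
    ext; simp
  simp only [bracketTerm, hIci]
  rw [Fin.sum_univ_succ (n := q + 1), sub_eq_add_neg]
  congr 1
  · refine Finset.sum_congr rfl fun l _ => ?_
    simp only [Fin.zero_le, if_true, Fin.val_zero, zero_add, Fin.castSucc_zero,
      Matrix.cons_val_zero, Matrix.cons_val_succ]
    rw [removeNth_zero_cons]
  · rw [← Finset.sum_neg_distrib]
    refine Finset.sum_congr rfl fun k _ => ?_
    rw [Fin.sum_univ_succ (n := q + 1), ← Finset.sum_neg_distrib]
    -- The second index is stored minus one, so `l = 0` denotes slot 1 and cannot exceed the first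
    -- index `k.succ`.
    rw [if_neg (by simp [Fin.le_def]), zero_add]
    refine Finset.sum_congr rfl fun l _ => ?_
    simp only [Fin.succ_le_succ_iff]
    split_ifs with h
    · rw [← Fin.succ_castSucc, removeNth_succ_cons, removeNth_succ_cons, Matrix.cons_val_succ,
        Matrix.cons_val_succ, ← iota_apply, ← iota_apply, iota_iota_swap]
      simp only [AlternatingMap.neg_apply, iota_apply, Fin.val_succ, smul_neg]
      congr 2
      ring
    · simp

lemma d_apply (q : ℕ) (α : Form R L q) (a : Fin (q + 1) → L) :
    𝒜.d q α a = ∑ k : Fin (q + 1), (-1 : ℤ) ^ (k : ℕ) • 𝒜.anchor (a k) (α (k.removeNth a)) +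
      𝒜.bracketTerm q α a := rfl

lemma bracketTerm_cons' (q : ℕ) (α : Form R L (q + 1)) (X : L) (w : Fin (q + 1) → L) :
    𝒜.bracketTerm (q + 1) α (Matrix.vecCons X w) =
      (∑ l : Fin (q + 1), (-1 : ℤ) ^ ((l : ℕ) + 1) •
        α (Matrix.vecCons (𝒜.bracket X (w l)) (l.removeNth w))) -
      𝒜.bracketTerm q (iota X α) w := by
  cases q with
  | zero => simp [bracketTerm, removeNth_zero_cons]
  | succ q => exact 𝒜.bracketTerm_cons q α X w

lemma lieDeriv_zero_apply (X : L) (α : Form R L 0) (w : Fin 0 → L) :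
    𝒜.lieDeriv X 0 α w = 𝒜.anchor X (α w) := by
  rw [lieDeriv, iota_apply, d_apply]
  simp [bracketTerm, removeNth_zero_cons]

/-- The value of the Lie derivative on a list of elements. -/
lemma lieDeriv_succ_apply (X : L) (q : ℕ) (α : Form R L (q + 1)) (w : Fin (q + 1) → L) :
    𝒜.lieDeriv X (q + 1) α w = 𝒜.anchor X (α w) - ∑ l : Fin (q + 1), (-1 : ℤ) ^ (l : ℕ) •
      α (Matrix.vecCons (𝒜.bracket X (w l)) (l.removeNth w)) := by
  -- Everything in `d i_X α` cancels against the terms of `i_X d α` in which `X` is neither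
  -- differentiated along nor bracketed.
  rw [lieDeriv, AlternatingMap.add_apply, iota_apply, d_apply, d_apply, bracketTerm_cons',
    Fin.sum_univ_succ]
  simp only [Fin.val_zero, pow_zero, one_smul, Matrix.cons_val_zero, removeNth_zero_cons,
    Matrix.cons_val_succ, removeNth_succ_cons, Fin.val_succ, pow_succ, mul_neg_one, neg_smul,
    Finset.sum_neg_distrib, iota_apply]
  ring

/-- `[i_Y, L_X] = -i_{[X, Y]}` in positive degree. -/
lemma iota_lieDeriv (X Y : L) (q : ℕ) (α : Form R L (q + 1)) :
    iota Y (𝒜.lieDeriv X (q + 1) α) =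
      𝒜.lieDeriv X q (iota Y α) - iota (𝒜.bracket X Y) α := by
  ext v
  rw [iota_apply, lieDeriv_succ_apply, AlternatingMap.sub_apply]
  cases q with
  | zero =>
    rw [lieDeriv_zero_apply]
    simp [iota_apply, removeNth_zero_cons]
  | succ q =>
    rw [lieDeriv_succ_apply, Fin.sum_univ_succ]
    -- With `Y` in slot 0, the term `l = 0` is the contraction with `[X, Y]`. In the others `Y` has
    -- to be moved back in front of the bracket.
    have h : ∀ l : Fin (q + 1), α (Matrix.vecCons (𝒜.bracket X (v l))
        (Matrix.vecCons Y (l.removeNth v))) =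
        -α (Matrix.vecCons Y (Matrix.vecCons (𝒜.bracket X (v l)) (l.removeNth v))) := fun l => by
      simp only [← iota_apply]
      rw [iota_iota_swap]; rfl
    simp only [Fin.val_zero, pow_zero, one_smul, Matrix.cons_val_zero, removeNth_zero_cons,
      Matrix.cons_val_succ, removeNth_succ_cons, Fin.val_succ, pow_succ, mul_neg_one, neg_smul,
      Finset.sum_neg_distrib, iota_apply, h, smul_neg, neg_neg]
    ring

end SkewAlgebroid

end GradedAlgebra

/-! ### The operator algebra of inhomogeneous forms -/

section GradedOperators

variable {R L : Type*} [CommRing R] [Algebra ℝ R] [AddCommGroup L] [Module ℝ L] [Module R L]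
  [IsScalarTower ℝ R L]

/-- Inhomogeneous forms. -/
structure Graded (R L : Type*) [CommRing R] [AddCommGroup L] [Module R L] where
  /-- the homogeneous component of degree `q` -/
  comp : (q : ℕ) → Form R L q

namespace Graded

@[ext] lemma ext {η θ : Graded R L} (h : ∀ q, η.comp q = θ.comp q) : η = θ := by
  cases η; cases θ; congr; exact funext h

instance : CoeFun (Graded R L) fun _ => (q : ℕ) → Form R L q := ⟨comp⟩

instance : Zero (Graded R L) := ⟨⟨0⟩⟩
instance : Add (Graded R L) := ⟨fun η θ => ⟨η.comp + θ.comp⟩⟩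
instance : Neg (Graded R L) := ⟨fun η => ⟨-η.comp⟩⟩
instance : Sub (Graded R L) := ⟨fun η θ => ⟨η.comp - θ.comp⟩⟩
instance : SMul R (Graded R L) := ⟨fun c η => ⟨c • η.comp⟩⟩
instance : SMul ℝ (Graded R L) := ⟨fun c η => ⟨c • η.comp⟩⟩
instance : SMul ℕ (Graded R L) := ⟨fun c η => ⟨c • η.comp⟩⟩
instance : SMul ℤ (Graded R L) := ⟨fun c η => ⟨c • η.comp⟩⟩

lemma comp_injective : Function.Injective (comp : Graded R L → _) :=
  fun _ _ h => Graded.ext (congrFun h)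

instance : AddCommGroup (Graded R L) :=
  comp_injective.addCommGroup comp rfl (fun _ _ => rfl) (fun _ => rfl) (fun _ _ => rfl)
    (fun _ _ => rfl) (fun _ _ => rfl)

/-- The components, as an additive map. -/
def compHom : Graded R L →+ ((q : ℕ) → Form R L q) where
  toFun := comp
  map_zero' := rfl
  map_add' _ _ := rfl

instance : Module R (Graded R L) := comp_injective.module R compHom fun _ _ => rfl
instance : Module ℝ (Graded R L) := comp_injective.module ℝ compHom fun _ _ => rfl

@[simp] lemma zero_apply (q : ℕ) : (0 : Graded R L) q = 0 := rfl
@[simp] lemma add_apply (η θ : Graded R L) (q : ℕ) : (η + θ) q = η q + θ q := rfl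
@[simp] lemma sub_apply (η θ : Graded R L) (q : ℕ) : (η - θ) q = η q - θ q := rfl
@[simp] lemma neg_apply (η : Graded R L) (q : ℕ) : (-η) q = -η q := rfl
@[simp] lemma smul_apply (f : R) (η : Graded R L) (q : ℕ) : (f • η) q = f • η q := rfl
@[simp] lemma real_smul_apply (c : ℝ) (η : Graded R L) (q : ℕ) : (c • η) q = c • η q := rfl

end Graded

/-- The contraction `i_X` on inhomogeneous forms. -/
def iG (X : L) : Module.End ℝ (Graded R L) where
  toFun η := ⟨fun q => iota X (η (q + 1))⟩
  map_add' _ _ := rfl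
  map_smul' _ _ := rfl

/-- Multiplication by a function on inhomogeneous forms. -/
def mG (f : R) : Module.End ℝ (Graded R L) where
  toFun η := f • η
  map_add' _ _ := smul_add _ _ _
  map_smul' c η := by
    ext q : 1
    exact smul_comm f c (η q)

/-- The exterior product `η ↦ α ∧ η` with a `1`-form. -/
def wedgeOne (α : Form R L 1) {q : ℕ} (η : Form R L q) : Form R L (q + 1) :=
  AlternatingMap.alternatizeUncurryFin ((linOne α).smulRight η)

/-- The exterior product with a `1`-form on inhomogeneous forms. -/
def eG (α : Form R L 1) : Module.End ℝ (Graded R L) where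
  toFun η := ⟨fun
    | 0 => 0
    | q + 1 => wedgeOne α (η q)⟩
  map_add' η η' := by
    ext q : 1
    cases q with
    | zero => simp
    | succ q =>
      simp only [wedgeOne, Graded.add_apply]
      rw [← AlternatingMap.alternatizeUncurryFin_add]
      congr 1; ext; simp
  map_smul' c η := by
    ext q : 1
    cases q with
    | zero => simp
    | succ q =>
      simp only [wedgeOne, Graded.real_smul_apply, RingHom.id_apply]
      rw [← AlternatingMap.alternatizeUncurryFin_smul]
      congr 1; ext; simp

@[simp] lemma iG_apply (X : L) (η : Graded R L) (q : ℕ) : iG X η q = iota X (η (q + 1)) := rfl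
@[simp] lemma mG_apply (f : R) (η : Graded R L) (q : ℕ) : mG f η q = f • η q := rfl
@[simp] lemma eG_apply_zero (α : Form R L 1) (η : Graded R L) : eG α η 0 = 0 := rfl
@[simp] lemma eG_apply_succ (α : Form R L 1) (η : Graded R L) (q : ℕ) :
    eG α η (q + 1) = wedgeOne α (η q) := rfl

/-- An operator which commutes, up to a constant factor, with all contractions and has no component
in degree `0` vanishes. -/
lemma end_eq_zero {T : Module.End ℝ (Graded R L)} (c : ℝ) (h0 : ∀ η, T η 0 = 0)
    (h : ∀ X, iG X * T = c • (T * iG X)) : T = 0 := by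
  -- Induction on the degree of the component: contracting `T η` in degree `q + 1` gives a multiple
  -- of a degree `q` component of `T`, applied to another form.
  have key : ∀ q η, T η q = 0 := by
    intro q
    induction q with
    | zero => exact h0
    | succ q ih =>
      intro η
      refine form_ext_iota fun X => ?_
      have := congrArg (fun η : Graded R L => η q) (LinearMap.congr_fun (h X) η)
      simp only [Module.End.mul_apply, iG_apply, LinearMap.smul_apply, Graded.real_smul_apply, ih,
        smul_zero] at this
      rw [this]; rfl
  exact LinearMap.ext fun η => Graded.ext fun q => key q η

lemma end_eq_zero_of_comm {T : Module.End ℝ (Graded R L)} (h0 : ∀ η, T η 0 = 0)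
    (h : ∀ X, iG X * T = T * iG X) : T = 0 :=
  end_eq_zero 1 h0 fun X => by rw [h, one_smul]

lemma end_eq_zero_of_anticomm {T : Module.End ℝ (Graded R L)} (h0 : ∀ η, T η 0 = 0)
    (h : ∀ X, iG X * T = -(T * iG X)) : T = 0 :=
  end_eq_zero (-1) h0 fun X => by rw [h, neg_one_smul]

lemma iG_add (X Y : L) : (iG (X + Y) : Module.End ℝ (Graded R L)) = iG X + iG Y := by
  ext η q : 2
  exact (η (q + 1)).curryLeft.map_add X Y

lemma iG_smul (f : R) (X : L) : (iG (f • X) : Module.End ℝ (Graded R L)) = mG f * iG X := by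
  ext η q : 2
  exact (η (q + 1)).curryLeft.map_smul f X

lemma iG_iG (X Y : L) : (iG X * iG Y : Module.End ℝ (Graded R L)) = -(iG Y * iG X) := by
  ext η q : 2
  exact iota_iota_swap _ _ _

lemma iG_mG (X : L) (f : R) : (iG X * mG f : Module.End ℝ (Graded R L)) = mG f * iG X := rfl

lemma mG_add (f g : R) : (mG (f + g) : Module.End ℝ (Graded R L)) = mG f + mG g := by
  ext η : 1
  exact add_smul _ _ _

lemma mG_sub (f g : R) : (mG (f - g) : Module.End ℝ (Graded R L)) = mG f - mG g := by
  ext η : 1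
  exact sub_smul _ _ _

lemma mG_mul (f g : R) : (mG (f * g) : Module.End ℝ (Graded R L)) = mG f * mG g := by
  ext η : 1
  exact mul_smul _ _ _

lemma iota_wedgeOne_zero (X : L) (α : Form R L 1) (η : Form R L 0) :
    iota X (wedgeOne α η) = α ![X] • η := by
  rw [wedgeOne, iota_alternatize_zero]
  rfl

lemma iota_wedgeOne_succ (X : L) (α : Form R L 1) {q : ℕ} (η : Form R L (q + 1)) :
    iota X (wedgeOne α η) = α ![X] • η - wedgeOne α (iota X η) := by
  rw [wedgeOne, iota_alternatize_succ]
  rfl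

lemma iG_eG (X : L) (α : Form R L 1) :
    (iG X * eG α : Module.End ℝ (Graded R L)) = mG (α ![X]) - eG α * iG X := by
  ext η q : 2
  cases q with
  | zero => simp [iota_wedgeOne_zero]
  | succ q => simp [iota_wedgeOne_succ]

/-- The pattern of many identities below: the difference of the two sides vanishes in degree 0 and
commutes or anticommutes with every contraction, so it is zero. The linear combination lists the
known commutation rules, multiplied on the side where they are substituted. -/
lemma eG_mG (α : Form R L 1) (f : R) :
    (eG α * mG f : Module.End ℝ (Graded R L)) = mG f * eG α := by
  rw [← sub_eq_zero]
  refine end_eq_zero_of_anticomm (fun η => by simp) fun X => ?_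
  have h1 := iG_eG X α
  have h2 := iG_mG X f
  have h3 : (mG f * mG (α ![X]) : Module.End ℝ (Graded R L)) = mG (α ![X]) * mG f := by
    rw [← mG_mul, ← mG_mul, mul_comm]
  linear_combination (norm := noncomm_ring) h1 * mG f - eG α * h2 - h2 * eG α - mG f * h1 - h3

lemma eG_add (α β : Form R L 1) : (eG (α + β) : Module.End ℝ (Graded R L)) = eG α + eG β := by
  rw [← sub_eq_zero]
  refine end_eq_zero_of_anticomm (fun η => by simp) fun X => ?_
  have h : (mG ((α + β) ![X]) : Module.End ℝ (Graded R L)) = mG (α ![X]) + mG (β ![X]) := mG_add _ _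
  simp only [mul_sub, mul_add, iG_eG, h]
  noncomm_ring

lemma eG_sub (α β : Form R L 1) : (eG (α - β) : Module.End ℝ (Graded R L)) = eG α - eG β := by
  rw [eq_sub_iff_add_eq, ← eG_add, sub_add_cancel]

lemma eG_eG (α β : Form R L 1) :
    (eG α * eG β : Module.End ℝ (Graded R L)) = -(eG β * eG α) := by
  rw [eq_neg_iff_add_eq_zero]
  refine end_eq_zero_of_comm (fun η => by simp) fun X => ?_
  have h1 := iG_eG X α
  have h2 := iG_eG X β
  have h3 := eG_mG α (β ![X])
  have h4 := eG_mG β (α ![X])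
  linear_combination (norm := noncomm_ring) h1 * eG β - eG α * h2 + h2 * eG α - eG β * h1 - h3 - h4

namespace SkewAlgebroid

variable (𝒜 : SkewAlgebroid R L)

/-- The differential on inhomogeneous forms. -/
noncomputable def dG : Module.End ℝ (Graded R L) where
  toFun η := ⟨fun
    | 0 => 0
    | q + 1 => 𝒜.d q (η q)⟩
  map_add' η η' := by
    ext q : 1
    cases q <;> simp
  map_smul' c η := by
    ext q : 1
    cases q <;> simp

@[simp] lemma dG_apply_zero (η : Graded R L) : 𝒜.dG η 0 = 0 := rfl
@[simp] lemma dG_apply_succ (η : Graded R L) (q : ℕ) : 𝒜.dG η (q + 1) = 𝒜.d q (η q) := rfl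

/-- The Lie derivative on inhomogeneous forms. -/
noncomputable def LG (X : L) : Module.End ℝ (Graded R L) := iG X * 𝒜.dG + 𝒜.dG * iG X

lemma LG_eq (X : L) : 𝒜.LG X = iG X * 𝒜.dG + 𝒜.dG * iG X := rfl

lemma LG_apply (X : L) (η : Graded R L) (q : ℕ) : 𝒜.LG X η q = 𝒜.lieDeriv X q (η q) := by
  cases q with
  | zero => simp [LG, lieDeriv]
  | succ q => simp [LG, lieDeriv]

lemma iG_LG (X Y : L) :
    iG Y * 𝒜.LG X = 𝒜.LG X * iG Y - iG (𝒜.bracket X Y) := by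
  ext η q : 2
  simp [LG_apply, iota_lieDeriv]

/-- In degree 0 this is the derivation property of the anchor; `iG_LG` carries it to all degrees. -/
lemma LG_mG (X : L) (f : R) : 𝒜.LG X * mG f = mG f * 𝒜.LG X + mG (𝒜.anchor X f) := by
  rw [← sub_eq_zero]
  refine end_eq_zero_of_comm (fun η => ?_) fun Y => ?_
  · ext v
    simp [LG_apply, lieDeriv_zero_apply, mul_comm]
  · have h1 := 𝒜.iG_LG X Y
    have h2 := iG_mG (R := R) Y f
    have h3 := iG_mG (R := R) Y (𝒜.anchor X f)
    have h4 := iG_mG (R := R) (𝒜.bracket X Y) f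
    linear_combination (norm := noncomm_ring) h1 * mG f + 𝒜.LG X * h2 - h2 * 𝒜.LG X - mG f * h1 -
      h3 - h4

/-- The Leibniz rule for `d` follows from the one for `L_X`, since contraction with `X` replaces `d`
by `L_X - d i_X`. -/
lemma dG_mG (f : R) : 𝒜.dG * mG f = mG f * 𝒜.dG + eG (𝒜.d 0 (fnForm f)) := by
  rw [← sub_eq_zero]
  refine end_eq_zero_of_anticomm (fun η => by simp) fun X => ?_
  have h1 := iG_mG (R := R) X f
  have h2 := iG_eG X (𝒜.d 0 (fnForm f))
  have h3 := 𝒜.LG_mG X f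
  rw [d_zero_apply] at h2
  change _ = mG (𝒜.anchor X f) - _ at h2
  rw [LG_eq] at h3
  linear_combination (norm := noncomm_ring) h3 - h1 * 𝒜.dG - h2 - 𝒜.dG * h1

/-- After contraction with `Y` what remains is `(L_X α)(Y) = ρ(X)(α(Y)) - α([X, Y])`. -/
lemma LG_eG (X : L) (α : Form R L 1) :
    𝒜.LG X * eG α = eG α * 𝒜.LG X + eG (𝒜.lieDeriv X 1 α) := by
  rw [← sub_eq_zero]
  refine end_eq_zero_of_anticomm (fun η => by simp [LG_apply, lieDeriv, iota]) fun Y => ?_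
  have h1 := 𝒜.iG_LG X Y
  have h2 := iG_eG Y α
  have h3 := iG_eG Y (𝒜.lieDeriv X 1 α)
  have h4 := iG_eG (𝒜.bracket X Y) α
  have h5 := 𝒜.LG_mG X (α ![Y])
  rw [lieDeriv_one_apply, mG_sub] at h3
  linear_combination (norm := noncomm_ring) h1 * eG α + 𝒜.LG X * h2 - h2 * 𝒜.LG X + eG α * h1
    - h3 - h4 + h5

/-- The graded commutator of `d` with the exterior product by `α`, which is the exterior product by
`d α`. -/
noncomputable def dWedge (α : Form R L 1) : Module.End ℝ (Graded R L) :=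
  𝒜.dG * eG α + eG α * 𝒜.dG

lemma dWedge_eq (α : Form R L 1) : 𝒜.dWedge α = 𝒜.dG * eG α + eG α * 𝒜.dG := rfl

/-- Expand `L_X` in `LG_eG` by Cartan's formula. The term `d(α(X))` inside `L_X α` cancels the one
from the Leibniz rule for the function `α(X)`, leaving `i_X dα`. -/
lemma dWedge_iG (α : Form R L 1) (X : L) :
    𝒜.dWedge α * iG X = iG X * 𝒜.dWedge α - eG (iota X (𝒜.d 1 α)) := by
  have h1 := 𝒜.LG_eG X α
  have h2 := iG_eG X α
  have h3 := 𝒜.dG_mG (α ![X])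
  have h4 : eG (𝒜.lieDeriv X 1 α) =
      eG (iota X (𝒜.d 1 α)) + eG (𝒜.d 0 (fnForm (α ![X]))) := by
    rw [← eG_add, lieDeriv]
    congr 3
    exact form_zero_eq_fnForm _
  rw [dWedge_eq]
  rw [LG_eq] at h1
  linear_combination (norm := noncomm_ring) -h1 + 𝒜.dG * h2 - h2 * 𝒜.dG + h3 - h4

lemma dWedge_mG (α : Form R L 1) (f : R) : 𝒜.dWedge α * mG f = mG f * 𝒜.dWedge α := by
  have h1 := eG_mG α f
  have h2 := 𝒜.dG_mG f
  have h3 := eG_eG α (𝒜.d 0 (fnForm f))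
  rw [dWedge_eq]
  linear_combination (norm := noncomm_ring) 𝒜.dG * h1 + h2 * eG α + eG α * h2 + h1 * 𝒜.dG + h3

lemma dWedge_eG (α β : Form R L 1) : 𝒜.dWedge α * eG β = eG β * 𝒜.dWedge α := by
  rw [← sub_eq_zero]
  refine end_eq_zero_of_anticomm (fun η => by simp [dWedge_eq]) fun X => ?_
  have h1 := 𝒜.dWedge_iG α X
  have h2 := iG_eG X β
  have h3 := 𝒜.dWedge_mG α (β ![X])
  have h4 := eG_eG (iota X (𝒜.d 1 α)) β
  linear_combination (norm := noncomm_ring) -h1 * eG β + 𝒜.dWedge α * h2 - h2 * 𝒜.dWedge α + h3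
    - eG β * h1 + h4

end SkewAlgebroid

end GradedOperators

/-! ### Interior products with multivectors, computed in local frames -/

section Frames

variable {E M F : Type*} {A : M → Type*}
  [NormedAddCommGroup E] [NormedSpace ℝ E] [FiniteDimensional ℝ E]
  [TopologicalSpace M] [ChartedSpace E M] [IsManifold 𝓘(ℝ, E) ∞ M] [T2Space M]
  [NormedAddCommGroup F] [NormedSpace ℝ F] [FiniteDimensional ℝ F]
  [TopologicalSpace (TotalSpace F A)] [∀ x, TopologicalSpace (A x)]
  [∀ x, AddCommGroup (A x)] [∀ x, Module ℝ (A x)]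
  [FiberBundle F A] [VectorBundle ℝ F A] [ContMDiffVectorBundle ∞ F A 𝓘(ℝ, E)]

/-- Inhomogeneous differential forms. -/
abbrev DGraded (E F : Type*) {M : Type*} (A : M → Type*)
    [NormedAddCommGroup E] [NormedSpace ℝ E] [TopologicalSpace M] [ChartedSpace E M]
    [NormedAddCommGroup F] [NormedSpace ℝ F]
    [TopologicalSpace (TotalSpace F A)] [∀ x, TopologicalSpace (A x)]
    [∀ x, AddCommGroup (A x)] [∀ x, Module ℝ (A x)] [FiberBundle F A] [VectorBundle ℝ F A] :
    Type _ :=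
  Graded (SmoothFn E M) (Sec E F A)

lemma Graded.sum_apply {R L ι : Type*} [CommRing R] [Algebra ℝ R] [AddCommGroup L] [Module ℝ L]
    [Module R L] [IsScalarTower ℝ R L] (s : Finset ι) (f : ι → Graded R L) (q : ℕ) :
    (∑ k ∈ s, f k) q = ∑ k ∈ s, f k q := by
  have := map_sum (Graded.compHom (R := R) (L := L)) f s
  exact (congrFun this q).trans (Finset.sum_apply _ _ _)

namespace DualFrame

variable {x : M} (P : DualFrame E F A x)

lemma χ_self : P.χ x = 1 := P.χ_eq.self_of_nhds

lemma χ_mul_contr (T : DForm E F A 1 →ₗ[SmoothFn E M] Sec E F A →ₗ[SmoothFn E M] SmoothFn E M) :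
    P.χ * contr T = ∑ k, T (P.ε k) (P.e k) := by
  ext y
  exact contr_eq T P y

lemma χ_smul_contrForm (q : ℕ)
    (T : DForm E F A 1 →ₗ[SmoothFn E M] Sec E F A →ₗ[SmoothFn E M] DForm E F A q) :
    P.χ • contrForm q T = ∑ k, T (P.ε k) (P.e k) := by
  ext1 v
  have h := P.χ_mul_contr (T.compr₂ (evalForm v))
  have h' := map_sum (evalForm v) (fun k => T (P.ε k) (P.e k)) Finset.univ
  exact h.trans h'.symm

lemma sum_apply_smul (β : DForm E F A 1) : ∑ k, β ![P.e k] • P.ε k = P.χ • β := by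
  ext1 v
  obtain ⟨u, rfl⟩ : ∃ u, v = ![u] := ⟨v 0, vec_one_eq v⟩
  have h1 := map_sum (evalForm ![u]) (fun k => β ![P.e k] • P.ε k) Finset.univ
  refine h1.trans ?_
  have h2 := congrArg (linOne β) (P.sum_eq u)
  rw [map_smul, map_sum] at h2
  refine Eq.trans ?_ h2.symm
  refine Finset.sum_congr rfl fun k _ => ?_
  rw [map_smul, map_smul]
  exact mul_comm (β ![P.e k]) (P.ε k ![u])

end DualFrame

/-- The cut-off `χ` is 1 at the base point, so an identity multiplied by `χ` for frames around every
point is the identity itself. This turns computations in local frames into global statements. -/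
lemma form_eq_of_frames {q : ℕ} {α β : DForm E F A q}
    (h : ∀ (x : M) (P : DualFrame E F A x), P.χ • α = P.χ • β) : α = β := by
  ext v x
  let P := dualFrame E F A x
  have h1 : P.χ x * α v x = P.χ x * β v x :=
    congrArg (fun γ : DForm E F A q => γ v x) (h x P)
  rwa [P.χ_self, one_mul, one_mul] at h1

lemma end_eq_of_frames {S T : Module.End ℝ (DGraded E F A)}
    (h : ∀ (x : M) (P : DualFrame E F A x), mG P.χ * S = mG P.χ * T) : S = T := by
  ext η q : 2
  refine form_eq_of_frames fun x P => ?_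
  exact congrArg (fun θ : DGraded E F A => θ q) (LinearMap.congr_fun (h x P) η)

/-- The interior product with a `p`-vector on inhomogeneous forms. -/
noncomputable def IV {p : ℕ} (V : MVec E F A p) : Module.End ℝ (DGraded E F A) where
  toFun η := ⟨fun m => interior p m (m + p) rfl V (η (m + p))⟩
  map_add' η θ := by
    ext m : 1
    exact map_add (interior p m (m + p) rfl V) _ _
  map_smul' c η := by
    ext m : 1
    exact map_smul ((interior p m (m + p) rfl V).restrictScalars ℝ) c (η (m + p))

lemma IV_apply {p : ℕ} (V : MVec E F A p) (η : DGraded E F A) {m n : ℕ} (h : m + p = n) :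
    IV V η m = interior p m n h V (η n) := by
  subst h; rfl

lemma IV_add {p : ℕ} (V W : MVec E F A p) : IV (V + W) = IV V + IV W := by
  ext η m : 2
  exact LinearMap.map_add₂ _ _ _ _

lemma IV_smul {p : ℕ} (f : SmoothFn E M) (V : MVec E F A p) : IV (f • V) = mG f * IV V := by
  ext η m : 2
  exact LinearMap.map_smul₂ _ _ _ _

lemma IV_zero {p : ℕ} : IV (0 : MVec E F A p) = 0 := by
  ext η m : 2
  exact LinearMap.map_zero₂ _ _

/-- `V ↦ i_V`, as an additive map. -/
noncomputable def IVHom (p : ℕ) : MVec E F A p →+ Module.End ℝ (DGraded E F A) where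
  toFun := IV
  map_zero' := IV_zero
  map_add' := IV_add

lemma IV_neg {p : ℕ} (V : MVec E F A p) : IV (-V) = -IV V := map_neg (IVHom p) V

lemma IV_sub {p : ℕ} (V W : MVec E F A p) : IV (V - W) = IV V - IV W := map_sub (IVHom p) V W

lemma IV_sum {p : ℕ} {ι : Type*} (s : Finset ι) (V : ι → MVec E F A p) :
    IV (∑ k ∈ s, V k) = ∑ k ∈ s, IV (V k) := map_sum (IVHom p) V s

lemma IV_degree_zero (V : MVec E F A 0) : IV V = mG (V ![]) := by
  ext η m : 2
  change V ![] • (η m).domDomCongr (finCongr _) = V ![] • η m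
  rfl

/-- The trace in the definition of `i_V` becomes a finite sum once multiplied by the cut-off; the
factor `p + 1` clears the normalization. -/
lemma IV_succ {x : M} (P : DualFrame E F A x) {p : ℕ} (V : MVec E F A (p + 1)) :
    (p + 1 : ℝ) • (mG P.χ * IV V) = ∑ k, iG (P.e k) * IV (iota (P.ε k) V) := by
  ext η m : 2
  rw [LinearMap.sum_apply, Graded.sum_apply]
  have h := P.χ_smul_contrForm m (AlternatingMap.curryLeftLinearMap ∘ₗ
        (interior p (m + 1) (m + (p + 1)) (by omega)).flip (η (m + (p + 1))) ∘ₗ V.curryLeft)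
  change (p + 1 : ℝ) • P.χ • (((p + 1 : ℝ)⁻¹) • contrForm m _) = _
  rw [smul_comm P.χ, smul_smul, mul_inv_cancel₀ (by positivity), one_smul, h]
  refine Finset.sum_congr rfl fun k _ => ?_
  rw [Module.End.mul_apply, iG_apply, IV_apply (iota (P.ε k) V) η (n := m + (p + 1)) (by omega)]
  rfl

/-- `i_V` is locally a sum of products of `p` contractions, each anticommuting with `i_X`. -/
lemma iG_IV (X : Sec E F A) {p : ℕ} (V : MVec E F A p) :
    iG X * IV V = (-1 : ℝ) ^ p • (IV V * iG X) := by
  induction p with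
  | zero => rw [IV_degree_zero, pow_zero, one_smul, iG_mG]
  | succ p ih =>
    refine end_eq_of_frames fun x P => ?_
    have hp : (p + 1 : ℝ) ≠ 0 := by positivity
    refine smul_right_injective _ hp ?_
    change (p + 1 : ℝ) • (mG P.χ * (iG X * IV V)) = (p + 1 : ℝ) • (mG P.χ * _)
    have h1 : (p + 1 : ℝ) • (mG P.χ * (iG X * IV V)) = iG X * ((p + 1 : ℝ) • (mG P.χ * IV V)) := by
      rw [mul_smul_comm, ← mul_assoc, ← mul_assoc, iG_mG]
    have h2 : (p + 1 : ℝ) • (mG P.χ * ((-1 : ℝ) ^ (p + 1) • (IV V * iG X))) =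
        (-1 : ℝ) ^ (p + 1) • (((p + 1 : ℝ) • (mG P.χ * IV V)) * iG X) := by
      rw [mul_smul_comm, smul_comm, smul_mul_assoc, mul_assoc]
    rw [h1, h2, IV_succ, Finset.mul_sum, Finset.sum_mul, Finset.smul_sum]
    refine Finset.sum_congr rfl fun k _ => ?_
    rw [← mul_assoc, iG_iG, neg_mul, mul_assoc, ih, pow_succ, mul_assoc]
    simp

lemma IV_one {V : MVec E F A 1} {X : Sec E F A} (h : ∀ β, β ![X] = V ![β]) : IV V = iG X := by
  refine end_eq_of_frames fun x P => ?_
  have h1 := IV_succ P V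
  rw [Nat.cast_zero, zero_add, one_smul] at h1
  rw [h1, ← iG_smul, P.sum_eq]
  rw [show iG (∑ k, P.ε k ![X] • P.e k) = ∑ k, iG (P.ε k ![X] • P.e k) from
    map_sum (AddMonoidHom.mk' (fun Y => (iG Y : Module.End ℝ (DGraded E F A))) iG_add) _ _]
  refine Finset.sum_congr rfl fun k _ => ?_
  rw [IV_degree_zero, iG_mG, iG_smul, h]
  rfl

/-- Induction through the frame expansion of `i_V`. The induction hypothesis produces `p + 1` copies
of `i_{i_α V}`; moving `e_α` past `i_{e_k}` leaves `α(e_k)`, and `∑ α(e_k) i_{ε^k} V = χ i_α V` adds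
one more copy. The total `p + 2` is the factor in `IV_succ`. -/
lemma IV_eG {p : ℕ} (V : MVec E F A (p + 1)) (α : DForm E F A 1) :
    IV V * eG α = (-1 : ℝ) ^ p • (IV (iota α V) - eG α * IV V) := by
  induction p with
  | zero =>
    obtain ⟨X, hX⟩ : ∃ X : Sec E F A, ∀ β : DForm E F A 1, β ![X] = V ![β] :=
      ⟨toSec (linOne V), fun β => apply_toSec β _⟩
    rw [IV_one hX, iG_eG, IV_degree_zero, pow_zero, one_smul, hX]
    rfl
  | succ p ih =>
    refine end_eq_of_frames fun x P => ?_
    have hp : ((p + 1 : ℕ) + 1 : ℝ) ≠ 0 := by positivity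
    refine smul_right_injective _ hp ?_
    change ((p + 1 : ℕ) + 1 : ℝ) • (mG P.χ * (IV V * eG α)) =
      ((p + 1 : ℕ) + 1 : ℝ) • (mG P.χ * _)
    have h1 : ((p + 1 : ℕ) + 1 : ℝ) • (mG P.χ * (IV V * eG α)) =
        (((p + 1 : ℕ) + 1 : ℝ) • (mG P.χ * IV V)) * eG α := by
      rw [smul_mul_assoc, mul_assoc]
    have h2 : mG P.χ * (eG α * IV V) = eG α * (mG P.χ * IV V) := by
      rw [← mul_assoc, ← eG_mG, mul_assoc]
    have h3 : mG P.χ * IV (iota α V) = ∑ k, mG (α ![P.e k]) * IV (iota (P.ε k) V) := by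
      have : P.χ • iota α V = ∑ k, α ![P.e k] • iota (P.ε k) V := by
        refine (V.curryLeft.map_smul P.χ α).symm.trans ?_
        rw [← P.sum_apply_smul α, map_sum]
        exact Finset.sum_congr rfl fun k _ => V.curryLeft.map_smul _ _
      rw [← IV_smul, this, IV_sum]
      exact Finset.sum_congr rfl fun k _ => IV_smul _ _
    have h4 := IV_succ P (iota α V)
    have h5 := IV_succ P V
    have h6 : ∀ k, iG (P.e k) * IV (iota (P.ε k) V) * eG α =
        (-1 : ℝ) ^ p • (iG (P.e k) * IV (iota α (iota (P.ε k) V)) -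
          mG (α ![P.e k]) * IV (iota (P.ε k) V) +
          eG α * (iG (P.e k) * IV (iota (P.ε k) V))) := by
      intro k
      rw [mul_assoc, ih, mul_smul_comm]
      congr 1
      have := iG_eG (P.e k) α
      linear_combination (norm := noncomm_ring) -this * IV (iota (P.ε k) V)
    have h7 : ∀ k, iG (P.e k) * IV (iota α (iota (P.ε k) V)) =
        -(iG (P.e k) * IV (iota (P.ε k) (iota α V))) := by
      intro k
      rw [iota_iota_swap, IV_neg, mul_neg]
    rw [h1, h5, Finset.sum_mul]
    simp only [h6, h7]
    rw [← Finset.smul_sum, Finset.sum_add_distrib, Finset.sum_sub_distrib, Finset.sum_neg_distrib,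
      ← h4, ← h3, ← Finset.mul_sum, ← h5, mul_smul_comm, mul_smul_comm, mul_sub, h2, pow_succ]
    push_cast
    module

/-- The operator `underline∂_{π,ψ}` on inhomogeneous forms. -/
noncomputable def underG (π : MVec E F A 2) (ψ : DForm E F A 3) :
    Module.End ℝ (DGraded E F A) where
  toFun η := ⟨fun q => underBd π ψ q (η (q + 1))⟩
  map_add' η θ := by
    ext q : 1
    exact map_add (underBd π ψ q) _ _
  map_smul' c η := by
    ext q : 1
    exact map_smul ((underBd π ψ q).restrictScalars ℝ) c (η (q + 1))

lemma underG_apply_zero (π : MVec E F A 2) (ψ : DForm E F A 3) (η : DGraded E F A) :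
    underG π ψ η 0 = 0 := rfl

lemma iG_IV_two (X : Sec E F A) (Q : MVec E F A 2) : iG X * IV Q = IV Q * iG X := by
  rw [iG_IV]; norm_num

/-- Either `X` is the vector fed to `ψ⁽²⁾`, or it is contracted into the form; in the second case it
passes the contraction with a bivector without a sign. -/
lemma iG_underG (π : MVec E F A 2) (ψ : DForm E F A 3) (X : Sec E F A) :
    iG X * underG π ψ = IV (psi2Bivector π ψ X) - underG π ψ * iG X := by
  ext η q : 2
  cases q with
  | zero =>
    refine (iota_alternatize_zero _ X).trans ?_
    exact (sub_zero _).symm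
  | succ q =>
    refine (iota_alternatize_succ _ X).trans ?_
    change interior 2 (q + 1) (q + 3) rfl (psi2Bivector π ψ X) (η (q + 3)) - _ =
      interior 2 (q + 1) (q + 3) rfl (psi2Bivector π ψ X) (η (q + 3)) -
      AlternatingMap.alternatizeUncurryFin
        ((interior 2 q (q + 2) rfl).flip (iota X (η (q + 3))) ∘ₗ psi2Bivector π ψ)
    congr 2
    ext1 v
    exact congrArg (fun θ : DGraded E F A => θ q)
      (LinearMap.congr_fun (iG_IV_two X (psi2Bivector π ψ v)) η)

lemma underG_mG (π : MVec E F A 2) (ψ : DForm E F A 3) (f : SmoothFn E M) :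
    underG π ψ * mG f = mG f * underG π ψ := by
  ext η q : 2
  exact map_smul (underBd π ψ q) f (η (q + 1))

lemma IV_mG {p : ℕ} (V : MVec E F A p) (f : SmoothFn E M) : IV V * mG f = mG f * IV V := by
  ext η q : 2
  exact map_smul (interior p q (q + p) rfl V) f (η (q + p))

/-- The operator `∂_π + underline∂_{π,ψ} + i_Y` on inhomogeneous forms. -/
noncomputable def SkewAlgebroid.bdG (𝒜 : SkewAlgebroid (SmoothFn E M) (Sec E F A))
    (π : MVec E F A 2) (ψ : DForm E F A 3) : Module.End ℝ (DGraded E F A) :=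
  𝒜.dG * IV π - IV π * 𝒜.dG + underG π ψ + iG (ySection π ψ)

lemma SkewAlgebroid.bdG_eq (𝒜 : SkewAlgebroid (SmoothFn E M) (Sec E F A))
    (π : MVec E F A 2) (ψ : DForm E F A 3) :
    𝒜.bdG π ψ = 𝒜.dG * IV π - IV π * 𝒜.dG + underG π ψ + iG (ySection π ψ) := rfl

lemma SkewAlgebroid.bdG_apply (𝒜 : SkewAlgebroid (SmoothFn E M) (Sec E F A))
    (π : MVec E F A 2) (ψ : DForm E F A 3) (η : DGraded E F A) (q : ℕ) :
    𝒜.bdG π ψ η q = 𝒜.bd π ψ q (η (q + 1)) := by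
  cases q with
  | zero =>
    -- `dG` has no component in degree 0, which agrees with the absence of the term `d i_π` on
    -- 1-forms in `bdPi`.
    change 0 - interior 2 0 2 rfl π (𝒜.d 1 (η 1)) + _ + _ =
      -interior 2 0 2 rfl π (𝒜.d 1 (η 1)) + _ + _
    rw [zero_sub]
    rfl
  | succ q => rfl

end Frames

/-! ### The bracket of `A*` as a derived bracket -/

section DualBracket

variable {E M F : Type*} {A : M → Type*}
  [NormedAddCommGroup E] [NormedSpace ℝ E] [FiniteDimensional ℝ E]
  [TopologicalSpace M] [ChartedSpace E M] [IsManifold 𝓘(ℝ, E) ∞ M] [T2Space M]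
  [NormedAddCommGroup F] [NormedSpace ℝ F] [FiniteDimensional ℝ F]
  [TopologicalSpace (TotalSpace F A)] [∀ x, TopologicalSpace (A x)]
  [∀ x, AddCommGroup (A x)] [∀ x, Module ℝ (A x)]
  [FiberBundle F A] [VectorBundle ℝ F A] [ContMDiffVectorBundle ∞ F A 𝓘(ℝ, E)]

/-- The case of bivectors in `IV_eG`, where `i_α π` is the section `π♯α`. It is the source of every
`π♯` below. -/
lemma IV_two_eG (π : MVec E F A 2) (α : DForm E F A 1) :
    IV π * eG α = eG α * IV π - iG (sharp π α) := by
  have h : IV (iota α π) = iG (sharp π α) := IV_one fun β => apply_sharp π α β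
  rw [IV_eG, h, pow_one, neg_one_smul, neg_sub]

lemma IV_psi2Bivector_eG (π : MVec E F A 2) (ψ : DForm E F A 3) (X : Sec E F A)
    (α : DForm E F A 1) :
    IV (psi2Bivector π ψ X) * eG α =
      eG α * IV (psi2Bivector π ψ X) - iG (sharp (psi2Bivector π ψ X) α) :=
  IV_two_eG _ α

namespace SkewAlgebroid

variable (𝒜 : SkewAlgebroid (SmoothFn E M) (Sec E F A)) (π : MVec E F A 2) (ψ : DForm E F A 3)

/-- The graded commutator of `∂_π` with the exterior product by `α`. -/
lemma bdPi_eG (α : DForm E F A 1) :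
    (𝒜.dG * IV π - IV π * 𝒜.dG) * eG α + eG α * (𝒜.dG * IV π - IV π * 𝒜.dG) =
      𝒜.dWedge α * IV π - IV π * 𝒜.dWedge α - 𝒜.LG (sharp π α) := by
  have h := IV_two_eG π α
  rw [dWedge_eq, LG_eq]
  linear_combination (norm := noncomm_ring) 𝒜.dG * h + h * 𝒜.dG

/-- Moving `e_β` past `i_π` leaves `i_{π♯β}`, whose commutator with `dα ∧` is the exterior product
by `i_{π♯β} dα`. The Lie derivative contributes `L_{π♯α} β`. -/
lemma bdPi_eG_eG (α β : DForm E F A 1) :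
    (𝒜.dWedge α * IV π - IV π * 𝒜.dWedge α - 𝒜.LG (sharp π α)) * eG β =
      eG β * (𝒜.dWedge α * IV π - IV π * 𝒜.dWedge α - 𝒜.LG (sharp π α)) +
      eG (iota (sharp π β) (𝒜.d 1 α)) - eG (𝒜.lieDeriv (sharp π α) 1 β) := by
  have h1 := IV_two_eG π β
  have h2 := 𝒜.dWedge_eG α β
  have h3 := 𝒜.LG_eG (sharp π α) β
  have h4 := 𝒜.dWedge_iG α (sharp π β)
  linear_combination (norm := noncomm_ring) 𝒜.dWedge α * h1 - h1 * 𝒜.dWedge α - h3 - h4 +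
    h2 * IV π - IV π * h2

lemma _root_.TwistedPoisson.iG_underG_eG (X : Sec E F A) (α : DForm E F A 1) :
    iG X * (underG π ψ * eG α + eG α * underG π ψ) =
      (underG π ψ * eG α + eG α * underG π ψ) * iG X - iG (sharp (psi2Bivector π ψ X) α) := by
  have h1 := iG_underG π ψ X
  have h2 := iG_eG X α
  have h3 := IV_psi2Bivector_eG π ψ X α
  have h4 := underG_mG π ψ (α ![X])
  linear_combination (norm := noncomm_ring) h1 * eG α + h2 * underG π ψ + h3 - underG π ψ * h2 -
    eG α * h1 - h4

/-- By `iG_underG_eG` the inner commutator meets `i_X` in a contraction with the section `⟨ψ⁽²⁾, X⟩♯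
α`, and the pairing of `β` with that section is `ψ(π♯α, π♯β, X)`. -/
lemma _root_.TwistedPoisson.underG_eG_eG (α β : DForm E F A 1) :
    (underG π ψ * eG α + eG α * underG π ψ) * eG β =
      eG β * (underG π ψ * eG α + eG α * underG π ψ) - eG (psi2 π ψ α β) := by
  rw [← sub_eq_zero]
  refine end_eq_zero_of_anticomm (fun η => by simp [underG_apply_zero]) fun X => ?_
  have h1 := iG_underG_eG π ψ X α
  have h2 := iG_eG X β
  have h3 : iG (sharp (psi2Bivector π ψ X) α) * eG β =
      mG (psi2 π ψ α β ![X]) - eG β * iG (sharp (psi2Bivector π ψ X) α) := by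
    rw [iG_eG, apply_sharp, psi2Bivector_apply, psi2_apply]
  have h4 := iG_eG X (psi2 π ψ α β)
  have h5 := underG_mG π ψ (β ![X])
  have h6 := eG_mG α (β ![X])
  linear_combination (norm := noncomm_ring) h1 * eG β + (underG π ψ * eG α + eG α * underG π ψ) * h2
    - h3 - h2 * (underG π ψ * eG α + eG α * underG π ψ) + eG β * h1 + h4
    + h5 * eG α + underG π ψ * h6 + h6 * underG π ψ + eG α * h5

/-- The graded commutator of `∂_π + underline∂_{π,ψ} + i_Y` with the exterior product by `α`. -/
noncomputable def dualLieG (α : DForm E F A 1) : Module.End ℝ (DGraded E F A) :=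
  𝒜.bdG π ψ * eG α + eG α * 𝒜.bdG π ψ

lemma dualLieG_eq (α : DForm E F A 1) :
    𝒜.dualLieG π ψ α = 𝒜.bdG π ψ * eG α + eG α * 𝒜.bdG π ψ := rfl

/-- Cartan's formula with `i_{π♯β} α = π(β, α) = -π(α, β)`. It converts the output of `bdPi_eG_eG`
into the terms of the bracket on `A*`. -/
lemma iota_sharp_d (α β : DForm E F A 1) :
    iota (sharp π β) (𝒜.d 1 α) =
      𝒜.lieDeriv (sharp π β) 1 α + 𝒜.d 0 (fnForm (π ![α, β])) := by
  have h1 : iota (sharp π β) α = -fnForm (π ![α, β]) := by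
    rw [form_zero_eq_fnForm (iota (sharp π β) α), iota_apply]
    have : (![β, α] : Fin 2 → DForm E F A 1) = ![α, β] ∘ Equiv.swap 0 1 := by
      ext1 i; fin_cases i <;> rfl
    have h := apply_sharp π β α
    rw [this, π.map_swap _ (by decide)] at h
    exact congrArg fnForm h
  rw [lieDeriv, h1, map_neg]
  abel

/-- The untwisted part of the bracket comes from `∂_π` and the term `ψ⁽²⁾(α, β)` from `underline∂`.
The summand `i_Y` contributes nothing: its commutator with `e_α` is multiplication by `⟨α, Y⟩`,
which commutes with `e_β`. -/
lemma dualLieG_eG (α β : DForm E F A 1) :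
    𝒜.dualLieG π ψ α * eG β =
      eG β * 𝒜.dualLieG π ψ α - eG ((dualAlgebroid 𝒜 π ψ).bracket α β) := by
  have h0 : eG ((dualAlgebroid 𝒜 π ψ).bracket α β) = eG (𝒜.lieDeriv (sharp π α) 1 β) -
      eG (iota (sharp π β) (𝒜.d 1 α)) + eG (psi2 π ψ α β) := by
    rw [← eG_sub, ← eG_add, iota_sharp_d, ← sub_sub]
    rfl
  have h1 := 𝒜.bdPi_eG π α
  have h2 := 𝒜.bdPi_eG_eG π α β
  have h3 := underG_eG_eG π ψ α β
  have h4 := iG_eG (ySection π ψ) α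
  have h5 := eG_mG β (α ![ySection π ψ])
  rw [h0, dualLieG_eq, bdG_eq]
  linear_combination (norm := noncomm_ring) h1 * eG β - eG β * h1 + h2 + h3 + h4 * eG β -
    eG β * h4 - h5

/-- Of the three summands only `∂_π` fails to be linear over functions; its commutator with `f` is
that of `df ∧` with `i_π`. -/
lemma bdG_mG (f : SmoothFn E M) :
    𝒜.bdG π ψ * mG f = mG f * 𝒜.bdG π ψ + iG (sharp π (𝒜.d 0 (fnForm f))) := by
  have h1 := 𝒜.dG_mG f
  have h2 := IV_mG π f
  have h3 := underG_mG π ψ f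
  have h4 := iG_mG (ySection π ψ) f
  have h5 := IV_two_eG π (𝒜.d 0 (fnForm f))
  rw [bdG_eq]
  linear_combination (norm := noncomm_ring) 𝒜.dG * h2 + h1 * IV π - IV π * h1 - h2 * 𝒜.dG + h3 +
    h4 - h5

end SkewAlgebroid

end DualBracket

/-! ### Exterior products with 1-forms and homogeneous elements -/

section Wedge

variable {R L : Type*} [CommRing R] [Algebra ℝ R] [AddCommGroup L] [Module ℝ L] [Module R L]
  [IsScalarTower ℝ R L]

/-- The exterior product with `1`-forms, as a bilinear map. -/
def wedgeOneBilin (q : ℕ) : Form R L 1 →ₗ[R] Form R L q →ₗ[R] Form R L (q + 1) :=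
  LinearMap.mk₂ R (fun α η' => wedgeOne α η')
    (fun α β η' => by
      simp only [wedgeOne]
      rw [← AlternatingMap.alternatizeUncurryFin_add]
      congr 1; ext; simp [add_mul])
    (fun c α η' => by
      simp only [wedgeOne]
      rw [← AlternatingMap.alternatizeUncurryFin_smul]
      congr 1; ext; simp [mul_assoc])
    (fun α η' θ => by
      simp only [wedgeOne]
      rw [← AlternatingMap.alternatizeUncurryFin_add]
      congr 1; ext; simp [mul_add])
    (fun c α η' => by
      simp only [wedgeOne]
      rw [← AlternatingMap.alternatizeUncurryFin_smul]
      congr 1; ext; simp [mul_left_comm])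

lemma wedgeOneBilin_apply {q : ℕ} (α : Form R L 1) (η' : Form R L q) :
    wedgeOneBilin q α η' = wedgeOne α η' := rfl

/-- The inhomogeneous form with a single component. -/
def Graded.single (n : ℕ) (η' : Form R L n) : Graded R L := ⟨Pi.single n η'⟩

@[simp] lemma Graded.single_same (n : ℕ) (η' : Form R L n) : Graded.single n η' n = η' :=
  Pi.single_eq_same n η'

lemma Graded.single_of_ne {n m : ℕ} (h : m ≠ n) (η' : Form R L n) : Graded.single n η' m = 0 :=
  Pi.single_eq_of_ne h η'

end Wedge

/-! ### Forms of top degree and detection by exterior products -/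

section VolumeForms

variable {E M F : Type*} {A : M → Type*}
  [NormedAddCommGroup E] [NormedSpace ℝ E] [FiniteDimensional ℝ E]
  [TopologicalSpace M] [ChartedSpace E M] [IsManifold 𝓘(ℝ, E) ∞ M] [T2Space M]
  [NormedAddCommGroup F] [NormedSpace ℝ F] [FiniteDimensional ℝ F]
  [TopologicalSpace (TotalSpace F A)] [∀ x, TopologicalSpace (A x)]
  [∀ x, AddCommGroup (A x)] [∀ x, Module ℝ (A x)]
  [FiberBundle F A] [VectorBundle ℝ F A] [ContMDiffVectorBundle ∞ F A 𝓘(ℝ, E)]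

namespace DualFrame

variable {x : M} (P : DualFrame E F A x)

/-- Antisymmetrization is linear, and `χ T = ∑ ε^k ⊗ T(e_k)` by the frame relation. -/
lemma sum_wedgeOne {q : ℕ} (T : Sec E F A →ₗ[SmoothFn E M] DForm E F A q) :
    ∑ k, wedgeOne (P.ε k) (T (P.e k)) = P.χ • AlternatingMap.alternatizeUncurryFin T := by
  have h : ∑ k, (linOne (P.ε k)).smulRight (T (P.e k)) = P.χ • T := by
    ext1 Y
    rw [LinearMap.sum_apply, LinearMap.smul_apply, ← map_smul, P.sum_eq, map_sum]
    exact Finset.sum_congr rfl fun k _ => (map_smul T _ _).symm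
  rw [← AlternatingMap.alternatizeUncurryFin_smul, ← h]
  exact (map_sum (AlternatingMap.alternatizeUncurryFinLM (R := SmoothFn E M) (M := Sec E F A)
    (N := SmoothFn E M) (n := q)) _ _).symm

/-- The value of a form at the base point in terms of its pullback to the coordinate module. -/
lemma apply_eq_compLinearMap {q : ℕ} (α : DForm E F A q) (v : Fin q → Sec E F A) :
    α v x = α.compLinearMap (Fintype.linearCombination (SmoothFn E M) P.e)
      (fun i k => P.ε k ![v i]) x := by
  have h : α.compLinearMap (Fintype.linearCombination (SmoothFn E M) P.e)
      (fun i k => P.ε k ![v i]) = P.χ ^ q * α v := by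
    rw [AlternatingMap.compLinearMap_apply]
    have : (fun i => Fintype.linearCombination (SmoothFn E M) P.e (fun k => P.ε k ![v i])) =
        fun i => P.χ • v i := by
      ext1 i
      rw [Fintype.linearCombination_apply, P.sum_eq]
    simp only [Function.comp_def, this]
    refine (α.toMultilinearMap.map_smul_univ (fun _ => P.χ) v).trans ?_
    simp
  rw [h]
  change _ = (P.χ ^ q) x * α v x
  have : (P.χ ^ q) x = P.χ x ^ q := rfl
  rw [this, P.χ_self, one_pow, one_mul]

end DualFrame

/-- At the base point of a frame the form is the pullback to a free module of rank `N`, where an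
alternating map is determined by its values on distinct basis vectors; there are too few of them. -/
lemma form_eq_zero_of_rank_lt {q : ℕ} (hq : Module.finrank ℝ F < q) (α : DForm E F A q) :
    α = 0 := by
  ext v x
  let P := dualFrame E F A x
  have h : α.compLinearMap (Fintype.linearCombination (SmoothFn E M) P.e) = 0 := by
    refine Module.Basis.ext_alternating (Pi.basisFun (SmoothFn E M) (Fin (Module.finrank ℝ F)))
      fun w hw => ?_
    have := Fintype.card_le_of_injective w hw
    simp only [Fintype.card_fin] at this
    omega
  rw [P.apply_eq_compLinearMap, h]
  rfl

/-- Forms of top degree are proportional at each point. -/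
lemma top_form_mul_comm (α β : DForm E F A (Module.finrank ℝ F))
    (v w : Fin (Module.finrank ℝ F) → Sec E F A) (x : M) :
    α v x * β w x = β v x * α w x := by
  let P := dualFrame E F A x
  have key : ∀ (γ : DForm E F A (Module.finrank ℝ F)) u, γ u x =
      γ.compLinearMap (Fintype.linearCombination (SmoothFn E M) P.e)
        (Pi.basisFun (SmoothFn E M) (Fin (Module.finrank ℝ F))) x *
      (Pi.basisFun (SmoothFn E M) (Fin (Module.finrank ℝ F))).det (fun i k => P.ε k ![u i]) x := by
    intro γ u
    rw [P.apply_eq_compLinearMap]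
    conv_lhs => rw [AlternatingMap.eq_smul_basis_det
      (Pi.basisFun (SmoothFn E M) (Fin (Module.finrank ℝ F)))
      (γ.compLinearMap (Fintype.linearCombination (SmoothFn E M) P.e))]
    rfl
  rw [key α v, key α w, key β v, key β w]
  ring

lemma exists_eq_smul_of_isVolumeForm {μ : DForm E F A (Module.finrank ℝ F)} (hμ : IsVolumeForm μ)
    (α : DForm E F A (Module.finrank ℝ F)) : ∃ h : SmoothFn E M, α = h • μ := by
  choose v hv using hμ
  -- The arguments `v x` may vary arbitrarily with `x`, but proportionality makes the quotient
  -- independent of them. Near `x₀` it can be computed with the fixed sections `v x₀`, and is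
  -- therefore smooth.
  refine ⟨⟨fun x => α (v x) x / μ (v x) x, fun x₀ => ?_⟩, ?_⟩
  · have h1 : ContMDiffAt 𝓘(ℝ, E) 𝓘(ℝ, ℝ) ∞ (fun x => α (v x₀) x / μ (v x₀) x) x₀ :=
      ((α (v x₀)).contMDiff x₀).div₀ ((μ (v x₀)).contMDiff x₀) (hv x₀)
    refine h1.congr_of_eventuallyEq ?_
    filter_upwards [(μ (v x₀)).contMDiff.continuous.continuousAt.eventually_ne (hv x₀)] with y hy
    rw [div_eq_div_iff (hv y) hy, top_form_mul_comm, mul_comm]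
  · ext w x
    change α w x = α (v x) x / μ (v x) x * μ w x
    rw [div_mul_eq_mul_div, eq_div_iff (hv x), top_form_mul_comm, mul_comm]

/-- The frame relation only says that the `N` sections `e_k` span at `x`. A top form not vanishing
at `x` is nonzero on them, which gives the diagonal relation of dual bases. -/
lemma DualFrame.ε_e_self {μ : DForm E F A (Module.finrank ℝ F)} (hμ : IsVolumeForm μ) {x : M}
    (P : DualFrame E F A x) (k : Fin (Module.finrank ℝ F)) : P.ε k ![P.e k] x = 1 := by
  have hne : μ P.e x ≠ 0 := by
    obtain ⟨v, hv⟩ := hμ x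
    intro h
    apply hv
    rw [P.apply_eq_compLinearMap, AlternatingMap.eq_smul_basis_det
      (Pi.basisFun (SmoothFn E M) (Fin (Module.finrank ℝ F)))
      (μ.compLinearMap (Fintype.linearCombination (SmoothFn E M) P.e))]
    have : μ.compLinearMap (Fintype.linearCombination (SmoothFn E M) P.e)
        (Pi.basisFun (SmoothFn E M) (Fin (Module.finrank ℝ F))) = μ P.e := by
      rw [AlternatingMap.compLinearMap_apply]
      congr 1
      ext1 i
      simp [Fintype.linearCombination_apply, Pi.single_apply]
    rw [this]
    change μ P.e x * _ = 0
    rw [h, zero_mul]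
  -- Replace `χ e_k` by `∑ ε^j(e_k) e_j` in slot `k`; every `j ≠ k` repeats an argument.
  have h1 : P.χ • μ P.e = P.ε k ![P.e k] • μ P.e := by
    conv_lhs => rw [← Function.update_eq_self k P.e]
    rw [← AlternatingMap.map_update_smul, P.sum_eq, AlternatingMap.map_update_sum,
      Finset.sum_eq_single k]
    · rw [AlternatingMap.map_update_smul, Function.update_eq_self]
    · intro j _ hj
      rw [AlternatingMap.map_update_smul, AlternatingMap.map_update_self _ _ hj.symm, smul_zero]
    · simp
  have h2 : P.χ x * μ P.e x = P.ε k ![P.e k] x * μ P.e x :=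
    congrArg (fun f : SmoothFn E M => f x) h1
  rw [P.χ_self] at h2
  exact (mul_right_cancel₀ hne h2).symm

/-- A form of degree less than the rank whose exterior products with all `1`-forms vanish is zero. -/
lemma form_eq_zero_of_wedgeOne {μ : DForm E F A (Module.finrank ℝ F)} (hμ : IsVolumeForm μ)
    {q : ℕ} (hq : q < Module.finrank ℝ F) {α : DForm E F A q} (h : ∀ β, wedgeOne β α = 0) :
    α = 0 := by
  ext v x
  let P := dualFrame E F A x
  cases q with
  | zero =>
    have h1 := congrArg (iota (P.e ⟨0, hq⟩)) (h (P.ε ⟨0, hq⟩))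
    rw [iota_wedgeOne_zero] at h1
    have h2 : P.ε ⟨0, hq⟩ ![P.e ⟨0, hq⟩] x * α v x = 0 :=
      congrArg (fun γ : DForm E F A 0 => γ v x) h1
    rwa [P.ε_e_self hμ, one_mul] at h2
  | succ q =>
    have h1 : ∀ k, P.ε k ![P.e k] • α = wedgeOne (P.ε k) (iota (P.e k) α) := by
      intro k
      have := congrArg (iota (P.e k)) (h (P.ε k))
      rw [iota_wedgeOne_succ] at this
      exact sub_eq_zero.1 this
    -- `∑ ε^k ∧ i_{e_k}` multiplies a form by its degree, here `q + 1`, whereas `∑ ε^k(e_k)` is the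
    -- rank at `x`. Since the degree is smaller than the rank, the form vanishes there.
    have h2 : ∑ k, P.ε k ![P.e k] • α = (q + 1) • (P.χ • α) := by
      simp only [h1]
      refine (P.sum_wedgeOne α.curryLeft).trans ?_
      rw [AlternatingMap.alternatizeUncurryFin_curryLeft, smul_comm]
    rw [← Finset.sum_smul] at h2
    have h3 : (∑ k, P.ε k ![P.e k]) x * α v x = (q + 1) • (P.χ x * α v x) := by
      have := congrArg (fun γ : DForm E F A (q + 1) => γ v x) h2
      exact this
    rw [fn_sum_apply] at h3
    simp only [P.ε_e_self hμ, P.χ_self, Finset.sum_const, Finset.card_univ, Fintype.card_fin,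
      nsmul_eq_mul, mul_one, one_mul] at h3
    change α v x = 0
    by_contra hne
    have := mul_right_cancel₀ hne h3
    norm_cast at this
    omega

/-- The component of degree `N` needs its own hypothesis, because every exterior product with a
1-form kills it. -/
lemma graded_eq_zero_of_eG {μ : DForm E F A (Module.finrank ℝ F)} (hμ : IsVolumeForm μ)
    {η : DGraded E F A} (h0 : η (Module.finrank ℝ F) = 0) (h : ∀ α, eG α η = 0) : η = 0 := by
  ext q : 1
  rcases lt_trichotomy q (Module.finrank ℝ F) with hq | rfl | hq
  · exact form_eq_zero_of_wedgeOne hμ hq fun β =>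
      congrArg (fun θ : DGraded E F A => θ (q + 1)) (h β)
  · exact h0
  · exact form_eq_zero_of_rank_lt hq _

end VolumeForms

/-! ### The star operator and its bijectivity -/

section HodgeStar

variable {E M F : Type*} {A : M → Type*}
  [NormedAddCommGroup E] [NormedSpace ℝ E] [FiniteDimensional ℝ E]
  [TopologicalSpace M] [ChartedSpace E M] [IsManifold 𝓘(ℝ, E) ∞ M] [T2Space M]
  [NormedAddCommGroup F] [NormedSpace ℝ F] [FiniteDimensional ℝ F]
  [TopologicalSpace (TotalSpace F A)] [∀ x, TopologicalSpace (A x)]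
  [∀ x, AddCommGroup (A x)] [∀ x, Module ℝ (A x)]
  [FiberBundle F A] [VectorBundle ℝ F A] [ContMDiffVectorBundle ∞ F A 𝓘(ℝ, E)]

instance {R L : Type*} [CommRing R] [Algebra ℝ R] [AddCommGroup L] [Module ℝ L] [Module R L]
    [IsScalarTower ℝ R L] : IsScalarTower ℝ R (Graded R L) :=
  ⟨fun c f η => by ext q : 1; exact smul_assoc c f (η q)⟩

variable {μ : DForm E F A (Module.finrank ℝ F)}

lemma eG_single_top (α : DForm E F A 1) :
    eG α (Graded.single (Module.finrank ℝ F) μ) = 0 := by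
  ext q : 1
  cases q with
  | zero => rfl
  | succ q =>
    rw [eG_apply_succ]
    by_cases h : q = Module.finrank ℝ F
    · subst h
      exact form_eq_zero_of_rank_lt (Nat.lt_succ_self _) _
    · rw [Graded.single_of_ne h]
      exact map_zero (wedgeOneBilin q α)

lemma IV_single_apply {p k : ℕ} (h : k + p = Module.finrank ℝ F) (V : MVec E F A p) :
    IV V (Graded.single (Module.finrank ℝ F) μ) k = hodgeStar μ p k h V := by
  rw [IV_apply V _ h, Graded.single_same]
  rfl

lemma IV_single_apply_of_ne {p k : ℕ} (h : k + p ≠ Module.finrank ℝ F) (V : MVec E F A p) :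
    IV V (Graded.single (Module.finrank ℝ F) μ) k = 0 := by
  rw [IV_apply V _ rfl, Graded.single_of_ne h, map_zero]

lemma IV_single {p k : ℕ} (h : k + p = Module.finrank ℝ F) (V : MVec E F A p) :
    IV V (Graded.single (Module.finrank ℝ F) μ) = Graded.single k (hodgeStar μ p k h V) := by
  ext q : 1
  by_cases hq : q = k
  · subst hq
    rw [IV_single_apply h, Graded.single_same]
  · rw [Graded.single_of_ne hq, IV_single_apply_of_ne (by omega)]

/-- Apply `IV_eG` to `μ`: the left side vanishes because `α ∧ μ` exceeds the top degree. -/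
lemma eG_IV_single {p : ℕ} (α : DForm E F A 1) (V : MVec E F A (p + 1)) :
    eG α (IV V (Graded.single (Module.finrank ℝ F) μ)) =
      IV (iota α V) (Graded.single (Module.finrank ℝ F) μ) := by
  have h := LinearMap.congr_fun (IV_eG V α) (Graded.single (Module.finrank ℝ F) μ)
  rw [Module.End.mul_apply, eG_single_top, map_zero, LinearMap.smul_apply] at h
  have h1 := (smul_eq_zero.1 h.symm).resolve_left (by positivity)
  exact (sub_eq_zero.1 h1).symm

lemma wedgeOne_hodgeStar {p k : ℕ} (h : k + (p + 1) = Module.finrank ℝ F) (α : DForm E F A 1)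
    (V : MVec E F A (p + 1)) :
    wedgeOne α (hodgeStar μ (p + 1) k h V) = hodgeStar μ p (k + 1) (by omega) (iota α V) := by
  rw [← IV_single_apply, ← IV_single_apply, ← eG_IV_single, eG_apply_succ]

/-- Contracting `V` down to a function reduces the claim to `f μ = 0`. There is no bound on `p`, so
it also shows that multivectors of degree above the rank vanish. -/
lemma eq_zero_of_IV_single (hμ : IsVolumeForm μ) {p : ℕ} {V : MVec E F A p}
    (h : IV V (Graded.single (Module.finrank ℝ F) μ) = 0) : V = 0 := by
  induction p with
  | zero =>
    rw [IV_degree_zero] at h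
    have h1 := congrArg (fun θ : DGraded E F A => θ (Module.finrank ℝ F)) h
    simp only [mG_apply, Graded.single_same, Graded.zero_apply] at h1
    ext v x
    obtain ⟨w, hw⟩ := hμ x
    rw [Subsingleton.elim v ![]]
    have h2 : V ![] x * μ w x = 0 := congrArg (fun γ : DForm E F A _ => γ w x) h1
    exact (mul_eq_zero.1 h2).resolve_right hw
  | succ p ih =>
    refine form_ext_iota fun α => ?_
    rw [ih (V := iota α V) (by rw [← eG_IV_single, h, map_zero])]
    rfl

lemma hodgeStar_injective (hμ : IsVolumeForm μ) {p k : ℕ} (h : k + p = Module.finrank ℝ F) :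
    Function.Injective (hodgeStar μ p k h) := by
  rw [injective_iff_map_eq_zero]
  intro V hV
  refine eq_zero_of_IV_single hμ ?_
  rw [IV_single h, hV]
  ext q : 1
  exact congrFun (Pi.single_zero k) q

/-- Skewness makes the family already alternating in all `p + 2` slots, so each slot contributes the
same term `W a`. -/
lemma iota_alternatize_of_skew {R L : Type*} [CommRing R] [Algebra ℝ R] [AddCommGroup L]
    [Module ℝ L] [Module R L] [IsScalarTower ℝ R L] {p : ℕ} (W : L →ₗ[R] Form R L (p + 1))
    (hW : ∀ a b, iota a (W b) = -iota b (W a)) (a : L) :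
    iota a (AlternatingMap.alternatizeUncurryFin W) = (p + 2) • W a := by
  have h : AlternatingMap.curryLeftLinearMap.flip a ∘ₗ W = -(W a).curryLeft :=
    LinearMap.ext fun b => hW a b
  have h1 : AlternatingMap.alternatizeUncurryFin (-(W a).curryLeft) =
      -AlternatingMap.alternatizeUncurryFin (W a).curryLeft :=
    map_neg (AlternatingMap.alternatizeUncurryFinLM (R := R) (M := L) (N := R) (n := p)) _
  rw [iota_alternatize_succ, h, h1, AlternatingMap.alternatizeUncurryFin_curryLeft]
  module

/-- A preimage `V` of `θ` must satisfy `*(i_α V) = α ∧ θ`. By induction this determines the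
contractions `W α`, and they assemble into a multivector because `α ∧ β ∧ θ` is skew in `α` and `β`.
-/
lemma hodgeStar_surjective (hμ : IsVolumeForm μ) {p k : ℕ} (h : k + p = Module.finrank ℝ F) :
    Function.Surjective (hodgeStar μ p k h) := by
  induction p generalizing k with
  | zero =>
    intro θ
    obtain rfl : k = Module.finrank ℝ F := by omega
    obtain ⟨f, rfl⟩ := exists_eq_smul_of_isVolumeForm hμ θ
    refine ⟨fnForm f, ?_⟩
    rw [← IV_single_apply, IV_degree_zero, mG_apply, Graded.single_same]
    rfl
  | succ p ih =>
    intro θ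
    have h' : k + 1 + p = Module.finrank ℝ F := by omega
    let e := LinearEquiv.ofBijective (hodgeStar μ p (k + 1) h')
      ⟨hodgeStar_injective hμ h', ih h'⟩
    let W : DForm E F A 1 →ₗ[SmoothFn E M] MVec E F A p :=
      e.symm.toLinearMap ∘ₗ (wedgeOneBilin k).flip θ
    have hWe : ∀ α, hodgeStar μ p (k + 1) h' (W α) = wedgeOne α θ := fun α =>
      e.apply_symm_apply (wedgeOne α θ)
    have hW : ∀ α, iota α (AlternatingMap.alternatizeUncurryFin W) = (p + 1) • W α := by
      intro α
      cases p with
      | zero => rw [iota_alternatize_zero, zero_add, one_smul]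
      | succ p =>
        refine iota_alternatize_of_skew W (fun α β => ?_) α
        refine hodgeStar_injective hμ (k := k + 2) (by omega) ?_
        rw [map_neg, ← wedgeOne_hodgeStar h', ← wedgeOne_hodgeStar h', hWe, hWe]
        have := congrArg (fun θ : DGraded E F A => θ (k + 2))
          (LinearMap.congr_fun (eG_eG α β) (Graded.single k θ))
        simpa using this
    -- The constant compensates for the `p + 1` equal contributions in the antisymmetrization of
    -- `W`.
    let V : MVec E F A (p + 1) := ((p + 1 : ℝ)⁻¹) • AlternatingMap.alternatizeUncurryFin W
    have hV : ∀ α, iota α V = W α := by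
      intro α
      have : iota α V = ((p + 1 : ℝ)⁻¹) • iota α (AlternatingMap.alternatizeUncurryFin W) := rfl
      rw [this, hW, ← Nat.cast_smul_eq_nsmul ℝ, smul_smul]
      push_cast
      rw [inv_mul_cancel₀ (by positivity), one_smul]
    refine ⟨V, ?_⟩
    rw [← sub_eq_zero]
    -- The two forms have the same exterior products with all 1-forms, and their degree `k` is below
    -- the rank.
    refine form_eq_zero_of_wedgeOne hμ (by omega) fun β => ?_
    have := map_sub (wedgeOneBilin k β) (hodgeStar μ (p + 1) k h V) θ
    refine this.trans ?_
    rw [wedgeOneBilin_apply, wedgeOneBilin_apply, wedgeOne_hodgeStar, hV, hWe, sub_self]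

lemma hodgeStar_bijective (hμ : IsVolumeForm μ) {p k : ℕ} (h : k + p = Module.finrank ℝ F) :
    Function.Bijective (hodgeStar μ p k h) :=
  ⟨hodgeStar_injective hμ h, hodgeStar_surjective hμ h⟩

lemma eG_iG_single (α : DForm E F A 1) (X : Sec E F A) :
    eG α (iG X (Graded.single (Module.finrank ℝ F) μ)) =
      α ![X] • Graded.single (Module.finrank ℝ F) μ := by
  have h := LinearMap.congr_fun (iG_eG X α) (Graded.single (Module.finrank ℝ F) μ)
  rw [Module.End.mul_apply, eG_single_top, map_zero] at h
  exact (sub_eq_zero.1 h.symm).symm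

end HodgeStar

/-! ### The boundary of a volume form and the intertwining relation -/

section ModularClass

variable {E M F : Type*} {A : M → Type*}
  [NormedAddCommGroup E] [NormedSpace ℝ E] [FiniteDimensional ℝ E]
  [TopologicalSpace M] [ChartedSpace E M] [IsManifold 𝓘(ℝ, E) ∞ M] [T2Space M]
  [NormedAddCommGroup F] [NormedSpace ℝ F] [FiniteDimensional ℝ F]
  [TopologicalSpace (TotalSpace F A)] [∀ x, TopologicalSpace (A x)]
  [∀ x, AddCommGroup (A x)] [∀ x, Module ℝ (A x)]
  [FiberBundle F A] [VectorBundle ℝ F A] [ContMDiffVectorBundle ∞ F A 𝓘(ℝ, E)]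
  {μ : DForm E F A (Module.finrank ℝ F)}

lemma χ_mul_IV_two {x : M} (P : DualFrame E F A x) (π : MVec E F A 2) :
    (2 : ℝ) • (mG P.χ * IV π) = ∑ k, iG (P.e k) * iG (sharp π (P.ε k)) := by
  have h := IV_succ P π
  norm_num at h
  rw [h]
  refine Finset.sum_congr rfl fun k _ => ?_
  rw [IV_one (X := sharp π (P.ε k)) fun β => apply_sharp π (P.ε k) β]

lemma χ_mul_underG {x : M} (P : DualFrame E F A x) (π : MVec E F A 2) (ψ : DForm E F A 3) :
    mG P.χ * underG π ψ = ∑ k, eG (P.ε k) * IV (psi2Bivector π ψ (P.e k)) := by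
  ext η q : 2
  rw [LinearMap.sum_apply, Graded.sum_apply]
  cases q with
  | zero =>
    rw [Module.End.mul_apply, mG_apply, underG_apply_zero, smul_zero]
    exact (Finset.sum_eq_zero fun k _ => rfl).symm
  | succ q => exact (P.sum_wedgeOne ((interior 2 q (q + 2) rfl).flip (η (q + 2)) ∘ₗ
      psi2Bivector π ψ)).symm

lemma graded_eq_of_frames {η θ : DGraded E F A}
    (h : ∀ (x : M) (P : DualFrame E F A x), P.χ • η = P.χ • θ) : η = θ := by
  ext q : 1
  exact form_eq_of_frames fun x P => congrArg (fun ζ : DGraded E F A => ζ q) (h x P)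

namespace SkewAlgebroid

variable (𝒜 : SkewAlgebroid (SmoothFn E M) (Sec E F A)) (π : MVec E F A 2) (ψ : DForm E F A 3)

lemma dG_single_top : 𝒜.dG (Graded.single (Module.finrank ℝ F) μ) = 0 := by
  ext q : 1
  cases q with
  | zero => rfl
  | succ q =>
    rw [dG_apply_succ]
    by_cases h : q = Module.finrank ℝ F
    · subst h
      exact form_eq_zero_of_rank_lt (Nat.lt_succ_self _) _
    · rw [Graded.single_of_ne h]
      exact map_zero (𝒜.d q)

lemma dWedge_single_top (α : DForm E F A 1) :
    𝒜.dWedge α (Graded.single (Module.finrank ℝ F) μ) = 0 := by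
  rw [dWedge_eq, LinearMap.add_apply, Module.End.mul_apply, Module.End.mul_apply, eG_single_top,
    dG_single_top, map_zero, map_zero, add_zero]

/-- `dα ∧ μ = 0`, so moving `dα ∧` past the two contractions leaves only the term in which both act
on `dα`. -/
lemma dWedge_iG_iG_single (α : DForm E F A 1) (X Y : Sec E F A) :
    𝒜.dWedge α (iG X (iG Y (Graded.single (Module.finrank ℝ F) μ))) =
      𝒜.d 1 α ![Y, X] • Graded.single (Module.finrank ℝ F) μ := by
  have h1 : ∀ (Z : Sec E F A) η,
      𝒜.dWedge α (iG Z η) = iG Z (𝒜.dWedge α η) - eG (iota Z (𝒜.d 1 α)) η :=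
    fun Z η => LinearMap.congr_fun (𝒜.dWedge_iG α Z) η
  have h2 : iota X (𝒜.d 1 α) ![Y] = -𝒜.d 1 α ![Y, X] := by
    have := congrArg (fun γ : DForm E F A 0 => γ ![]) (iota_iota_swap Y X (𝒜.d 1 α))
    exact this
  rw [h1, h1, dWedge_single_top, map_zero, zero_sub, map_neg, eG_iG_single, h2]
  have h3 := LinearMap.congr_fun (iG_eG X (iota Y (𝒜.d 1 α)))
    (Graded.single (Module.finrank ℝ F) μ)
  rw [Module.End.mul_apply, eG_single_top, map_zero] at h3
  have h4 : iG X (eG (iota Y (𝒜.d 1 α)) (Graded.single (Module.finrank ℝ F) μ)) = 0 := by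
    rw [eG_single_top, map_zero]
  rw [h4, neg_zero, zero_sub, neg_smul, neg_neg]

/-- In a frame both sides expand with coefficients `dα(π♯ε^k, e_k)`; the factor 2 comes from
`IV_succ` for bivectors. -/
lemma dWedge_IV_two_single (α : DForm E F A 1) :
    𝒜.dWedge α (IV π (Graded.single (Module.finrank ℝ F) μ)) =
      interior 2 0 2 rfl π (𝒜.d 1 α) ![] • Graded.single (Module.finrank ℝ F) μ := by
  refine graded_eq_of_frames fun x P => ?_
  refine smul_right_injective _ (two_ne_zero (α := ℝ)) ?_
  change (2 : ℝ) • P.χ • _ = (2 : ℝ) • P.χ • _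
  have h1 : (2 : ℝ) • P.χ • 𝒜.dWedge α (IV π (Graded.single (Module.finrank ℝ F) μ)) =
      𝒜.dWedge α (((2 : ℝ) • (mG P.χ * IV π) : Module.End ℝ (DGraded E F A))
        (Graded.single (Module.finrank ℝ F) μ)) := by
    rw [LinearMap.smul_apply, map_smul]
    congr 1
    exact (LinearMap.congr_fun (𝒜.dWedge_mG α P.χ) _).symm
  have h2 : (2 : ℝ) • P.χ • (interior 2 0 2 rfl π (𝒜.d 1 α) ![] : SmoothFn E M) =
      ∑ k, 𝒜.d 1 α ![sharp π (P.ε k), P.e k] := by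
    have h3 := congrArg (fun η : DGraded E F A => η 0) (LinearMap.congr_fun (χ_mul_IV_two P π)
      (Graded.single 2 (𝒜.d 1 α)))
    rw [LinearMap.sum_apply] at h3
    simp only [Graded.sum_apply] at h3
    have h4 := congrArg (evalForm ![]) h3
    rw [map_sum] at h4
    simpa [IV_apply _ _ (rfl : 0 + 2 = 2), evalForm, iota_apply] using h4
  rw [h1, χ_mul_IV_two, LinearMap.sum_apply, map_sum]
  have h5 : (2 : ℝ) • P.χ • (interior 2 0 2 rfl π (𝒜.d 1 α) ![] : SmoothFn E M) •
      Graded.single (Module.finrank ℝ F) μ =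
      ((2 : ℝ) • P.χ • (interior 2 0 2 rfl π (𝒜.d 1 α) ![] : SmoothFn E M)) •
      Graded.single (Module.finrank ℝ F) μ := by
    rw [smul_assoc, smul_assoc]
  rw [h5, h2, Finset.sum_smul]
  exact Finset.sum_congr rfl fun k _ => 𝒜.dWedge_iG_iG_single α _ _

lemma _root_.TwistedPoisson.apply_ySection (α : DForm E F A 1) :
    α ![ySection π ψ] = (1 / 2 : ℝ) • contr ((psi2 π ψ).compr₂ linOne α) :=
  apply_toSec α _

/-- In a frame, `α ∧ ε^k ∧ i_Q μ` with `Q = ⟨ψ⁽²⁾, e_k⟩` equals `-Q(α, ε^k) μ`. Summing over `k`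
gives minus the trace of `ψ⁽²⁾(α, ·)`, which is twice `⟨α, Y⟩` by the definition of `Y`. -/
lemma _root_.TwistedPoisson.eG_underG_single (α : DForm E F A 1) :
    eG α (underG π ψ (Graded.single (Module.finrank ℝ F) μ)) =
      -((2 : ℝ) • α ![ySection π ψ]) • Graded.single (Module.finrank ℝ F) μ := by
  refine graded_eq_of_frames fun x P => ?_
  have h1 : P.χ • eG α (underG π ψ (Graded.single (Module.finrank ℝ F) μ)) =
      eG α ((mG P.χ * underG π ψ : Module.End ℝ (DGraded E F A)) (Graded.single (Module.finrank ℝ F) μ)) :=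
    (LinearMap.congr_fun (eG_mG α P.χ) _).symm
  have h2 : (2 : ℝ) • α ![ySection π ψ] = contr ((psi2 π ψ).compr₂ linOne α) := by
    rw [apply_ySection, smul_smul]; norm_num
  have h3 : ∀ k, eG α (eG (P.ε k) (IV (psi2Bivector π ψ (P.e k))
      (Graded.single (Module.finrank ℝ F) μ))) =
      -(psi2 π ψ).compr₂ linOne α (P.ε k) (P.e k) • Graded.single (Module.finrank ℝ F) μ := by
    intro k
    have h4 : iota α (iota (P.ε k) (psi2Bivector π ψ (P.e k))) ![] =
        -(psi2 π ψ).compr₂ linOne α (P.ε k) (P.e k) := by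
      rw [iota_iota_swap]
      exact congrArg Neg.neg (psi2Bivector_apply π ψ (P.e k) α (P.ε k))
    rw [eG_IV_single, eG_IV_single, IV_degree_zero, h4]
    rfl
  rw [h1, χ_mul_underG, LinearMap.sum_apply, map_sum, h2, smul_smul, mul_neg, P.χ_mul_contr,
    ← Finset.sum_neg_distrib, Finset.sum_smul]
  exact Finset.sum_congr rfl fun k _ => h3 k

lemma bdG_single_top_degree {η : DGraded E F A} :
    𝒜.bdG π ψ η (Module.finrank ℝ F) = 0 := by
  rw [bdG_apply, form_eq_zero_of_rank_lt (Nat.lt_succ_self _) (η (Module.finrank ℝ F + 1)), map_zero]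

lemma LG_single (X : Sec E F A) :
    𝒜.LG X (Graded.single (Module.finrank ℝ F) μ) =
      Graded.single _ (𝒜.lieDeriv X (Module.finrank ℝ F) μ) := by
  ext q : 1
  rw [LG_apply]
  by_cases h : q = Module.finrank ℝ F
  · subst h
    rw [Graded.single_same, Graded.single_same]
  · rw [Graded.single_of_ne h, Graded.single_of_ne h]
    cases q <;> simp [lieDeriv, iota]

variable {𝒜 π ψ}

/-- If the modular section of `μ` vanishes, then so does the boundary of `μ`. -/
lemma bdG_single_eq_zero (hμ : IsVolumeForm μ)
    (hY : ∀ α : DForm E F A 1, 𝒜.lieDeriv (sharp π α) (Module.finrank ℝ F) μ =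
      interior 2 0 2 rfl π (𝒜.d 1 α) ![] • μ - α ![ySection π ψ] • μ) :
    𝒜.bdG π ψ (Graded.single (Module.finrank ℝ F) μ) = 0 := by
  -- After exterior multiplication by `α`, the three summands of the operator contribute `⟨α,Y⟩μ`
  -- (by `hY`), `-2⟨α,Y⟩μ` and `⟨α,Y⟩μ`.
  refine graded_eq_zero_of_eG hμ (𝒜.bdG_single_top_degree π ψ) fun α => ?_
  have h1 := LinearMap.congr_fun (𝒜.bdPi_eG π α) (Graded.single (Module.finrank ℝ F) μ)
  simp only [LinearMap.add_apply, LinearMap.sub_apply, Module.End.mul_apply, eG_single_top,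
    map_zero, dWedge_single_top, dWedge_IV_two_single, LG_single, hY] at h1
  have h2 : Graded.single (Module.finrank ℝ F) (interior 2 0 2 rfl π (𝒜.d 1 α) ![] • μ -
      α ![ySection π ψ] • μ) = interior 2 0 2 rfl π (𝒜.d 1 α) ![] •
      Graded.single (Module.finrank ℝ F) μ -
      α ![ySection π ψ] • Graded.single (Module.finrank ℝ F) μ := by
    ext q : 1
    by_cases h : q = Module.finrank ℝ F
    · subst h; simp
    · simp [Graded.single_of_ne h]
  rw [h2] at h1
  have h3 : ((2 : ℝ) • α ![ySection π ψ]) • Graded.single (Module.finrank ℝ F) μ =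
      α ![ySection π ψ] • Graded.single (Module.finrank ℝ F) μ +
        α ![ySection π ψ] • Graded.single (Module.finrank ℝ F) μ := by
    rw [two_smul, add_smul]
  rw [bdG_eq, LinearMap.add_apply, LinearMap.add_apply, map_add, map_add, eG_underG_single,
    eG_iG_single, neg_smul, h3]
  simp only [LinearMap.sub_apply, Module.End.mul_apply]
  rw [zero_add, sub_zero] at h1
  rw [h1]
  abel

/-- Since `μ` has zero boundary, the boundary of `fμ` is `i_{π♯df} μ`. Its exterior product with `α`
is `⟨α, π♯df⟩ μ`, and skewness of `π` turns the coefficient into `-ρ(π♯α) f`. -/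
lemma dualLieG_IV_single_zero (hbd : 𝒜.bdG π ψ (Graded.single (Module.finrank ℝ F) μ) = 0)
    (α : DForm E F A 1) (V : MVec E F A 0) :
    𝒜.dualLieG π ψ α (IV V (Graded.single (Module.finrank ℝ F) μ)) =
      -IV ((dualAlgebroid 𝒜 π ψ).lieDeriv α 0 V) (Graded.single (Module.finrank ℝ F) μ) := by
  have h1 := LinearMap.congr_fun (𝒜.bdG_mG π ψ (V ![])) (Graded.single (Module.finrank ℝ F) μ)
  have h2 := LinearMap.congr_fun (eG_mG α (V ![])) (Graded.single (Module.finrank ℝ F) μ)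
  simp only [LinearMap.add_apply, Module.End.mul_apply, hbd, map_zero, zero_add,
    eG_single_top] at h1 h2
  have h3 : α ![sharp π (𝒜.d 0 (fnForm (V ![])))] = -𝒜.anchor (sharp π α) (V ![]) := by
    rw [apply_sharp]
    have : (![𝒜.d 0 (fnForm (V ![])), α] : Fin 2 → DForm E F A 1) =
        ![α, 𝒜.d 0 (fnForm (V ![]))] ∘ Equiv.swap 0 1 := by
      ext1 i; fin_cases i <;> rfl
    rw [this, π.map_swap _ (by decide), ← apply_sharp, d_zero_apply]
    rfl
  rw [dualLieG_eq, LinearMap.add_apply, Module.End.mul_apply, Module.End.mul_apply,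
    IV_degree_zero, IV_degree_zero, h2, map_zero, zero_add, h1, eG_iG_single, h3,
    lieDeriv_zero_apply, neg_smul]
  rfl

lemma eG_apply_eq_zero {α : DForm E F A 1} {η : DGraded E F A} {m : ℕ}
    (h : ∀ n, n + 1 = m → η n = 0) : eG α η m = 0 := by
  cases m with
  | zero => rfl
  | succ m =>
    rw [eG_apply_succ, h m rfl]
    exact map_zero (wedgeOneBilin m α)

/-- Induction on `p`, testing with `e_β`. The commutator with `e_β` on the left (`dualLieG_eG`) and
that of the Lie derivative with `i_β` on the right (`iota_lieDeriv` for `A*`) involve the same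
bracket, and the star exchanges `i_β` with `e_β`. -/
lemma dualLieG_IV_single (hμ : IsVolumeForm μ)
    (hbd : 𝒜.bdG π ψ (Graded.single (Module.finrank ℝ F) μ) = 0)
    (α : DForm E F A 1) {p : ℕ} (V : MVec E F A p) :
    𝒜.dualLieG π ψ α (IV V (Graded.single (Module.finrank ℝ F) μ)) =
      -IV ((dualAlgebroid 𝒜 π ψ).lieDeriv α p V) (Graded.single (Module.finrank ℝ F) μ) := by
  induction p with
  | zero => exact dualLieG_IV_single_zero hbd α V
  | succ p ih =>
    rw [← add_eq_zero_iff_eq_neg]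
    refine graded_eq_zero_of_eG hμ ?_ fun β => ?_
    -- Both terms preserve the degree of `*V`, which is below the rank as `V` has positive degree.
    · rw [Graded.add_apply, dualLieG_eq, LinearMap.add_apply, Graded.add_apply,
        Module.End.mul_apply, bdG_single_top_degree, Module.End.mul_apply,
        IV_single_apply_of_ne (by omega), eG_apply_eq_zero, add_zero, add_zero]
      intro n hn
      rw [bdG_apply, IV_single_apply_of_ne (by omega), map_zero]
    · have h1 := LinearMap.congr_fun (𝒜.dualLieG_eG π ψ α β)
        (IV V (Graded.single (Module.finrank ℝ F) μ))
      simp only [LinearMap.sub_apply, Module.End.mul_apply, eG_IV_single, ih] at h1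
      rw [map_add, eG_IV_single, iota_lieDeriv, IV_sub, LinearMap.sub_apply]
      rw [← sub_eq_zero] at h1
      rw [← neg_eq_zero, ← h1]
      abel

/-- Under the star operator of a form with vanishing boundary, `d_{π,ψ}` corresponds to the opposite
of `∂_π + underline∂_{π,ψ} + i_Y`. -/
lemma bdG_IV_single (hμ : IsVolumeForm μ)
    (hbd : 𝒜.bdG π ψ (Graded.single (Module.finrank ℝ F) μ) = 0) {p : ℕ} (V : MVec E F A p) :
    𝒜.bdG π ψ (IV V (Graded.single (Module.finrank ℝ F) μ)) =
      -IV ((dualAlgebroid 𝒜 π ψ).d p V) (Graded.single (Module.finrank ℝ F) μ) := by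
  have hdeg : ∀ {p : ℕ} (V : MVec E F A p),
      (𝒜.bdG π ψ (IV V (Graded.single (Module.finrank ℝ F) μ)) +
        IV ((dualAlgebroid 𝒜 π ψ).d p V) (Graded.single (Module.finrank ℝ F) μ))
        (Module.finrank ℝ F) = 0 := by
    intro p V
    rw [Graded.add_apply, bdG_single_top_degree, IV_single_apply_of_ne (by omega), add_zero]
  have hlie : ∀ {p : ℕ} (V : MVec E F A p) (α : DForm E F A 1),
      𝒜.bdG π ψ (eG α (IV V (Graded.single (Module.finrank ℝ F) μ))) +
        eG α (𝒜.bdG π ψ (IV V (Graded.single (Module.finrank ℝ F) μ))) =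
      -IV ((dualAlgebroid 𝒜 π ψ).lieDeriv α p V) (Graded.single (Module.finrank ℝ F) μ) :=
    fun V α => dualLieG_IV_single hμ hbd α V
  rw [← add_eq_zero_iff_eq_neg]
  induction p with
  | zero =>
    refine graded_eq_zero_of_eG hμ (hdeg V) fun α => ?_
    -- For a function `V` the form `α ∧ Vμ` vanishes, and the Lie derivative of `V` along `α` is
    -- just `i_α dV`.
    have h1 := hlie V α
    have h2 := LinearMap.congr_fun (eG_mG α (V ![])) (Graded.single (Module.finrank ℝ F) μ)
    simp only [Module.End.mul_apply, eG_single_top, map_zero] at h2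
    rw [IV_degree_zero, h2, map_zero, zero_add] at h1
    rw [map_add, eG_IV_single, IV_degree_zero, h1]
    exact neg_add_cancel _
  | succ p ih =>
    refine graded_eq_zero_of_eG hμ (hdeg V) fun α => ?_
    -- By Cartan's formula in `A*`, the Lie derivative of `V` along `α` is `i_α dV + d i_α V`. The
    -- second part is removed by the induction hypothesis for `i_α V`, leaving `α ∧ D *V = -*(i_α
    -- dV)`.
    have h1 := hlie V α
    rw [eG_IV_single, lieDeriv, IV_add, LinearMap.add_apply] at h1
    have h2 := ih (iota α V)
    rw [map_add, eG_IV_single]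
    rw [← sub_eq_zero] at h1
    have h3 := congrArg₂ (· - ·) h1 h2
    simp only [sub_zero] at h3
    rw [← h3]
    abel

end SkewAlgebroid

end ModularClass

/-- A linear equivalence which identifies cycles and boundaries induces an isomorphism of the
quotients. -/
lemma exists_cycleQuotient_equiv {V W : Type*} [AddCommGroup V] [Module ℝ V] [AddCommGroup W]
    [Module ℝ W] (e : V ≃ₗ[ℝ] W) {Z B : Submodule ℝ V} {Z' B' : Submodule ℝ W}
    (hZ : ∀ v, v ∈ Z ↔ e v ∈ Z') (hB : ∀ v, v ∈ B ↔ e v ∈ B') :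
    ∃ Φ : CycleQuotient Z B ≃ₗ[ℝ] CycleQuotient Z' B', ∀ z : Z, ∃ w : Z', (w : W) = e z ∧
      Φ (cycleClass Z B z) = cycleClass Z' B' w := by
  have hmap : Z.map (e : V →ₗ[ℝ] W) = Z' := by
    ext w
    rw [Submodule.mem_map_equiv, hZ, e.apply_symm_apply]
  let e' : Z ≃ₗ[ℝ] Z' := e.ofSubmodules Z Z' hmap
  have he' : ∀ z : Z, (e' z : W) = e z := fun z => rfl
  have hmap' : (B.submoduleOf Z).map (e' : Z →ₗ[ℝ] Z') = B'.submoduleOf Z' := by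
    ext w
    rw [Submodule.mem_map_equiv]
    change (e'.symm w : V) ∈ B ↔ (w : W) ∈ B'
    rw [hB, ← he', e'.apply_symm_apply]
  exact ⟨Submodule.Quotient.equiv _ _ e' hmap', fun z => ⟨e' z, he' z, rfl⟩⟩

/-! ### Rescaling by `exp g` and passage to homology -/

section Isomorphism

variable {E M F : Type*} {A : M → Type*}
  [NormedAddCommGroup E] [NormedSpace ℝ E] [FiniteDimensional ℝ E]
  [TopologicalSpace M] [ChartedSpace E M] [IsManifold 𝓘(ℝ, E) ∞ M] [T2Space M]
  [NormedAddCommGroup F] [NormedSpace ℝ F] [FiniteDimensional ℝ F]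
  [TopologicalSpace (TotalSpace F A)] [∀ x, TopologicalSpace (A x)]
  [∀ x, AddCommGroup (A x)] [∀ x, Module ℝ (A x)]
  [FiberBundle F A] [VectorBundle ℝ F A] [ContMDiffVectorBundle ∞ F A 𝓘(ℝ, E)]

lemma sec_eq_of_pairing {X Y : Sec E F A} (h : ∀ α : DForm E F A 1, α ![X] = α ![Y]) : X = Y := by
  ext x
  let P := dualFrame E F A x
  have h1 : P.χ • X = P.χ • Y := by
    rw [P.sum_eq, P.sum_eq]
    exact Finset.sum_congr rfl fun k _ => by rw [h]
  have h2 : P.χ x • X x = P.χ x • Y x := congrArg (fun s : Sec E F A => s x) h1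
  rwa [P.χ_self, one_smul, one_smul] at h2

lemma IsVolumeForm.smul {μ : DForm E F A (Module.finrank ℝ F)} (hμ : IsVolumeForm μ)
    {f : SmoothFn E M} (hf : ∀ x, f x ≠ 0) : IsVolumeForm (f • μ) := fun x => by
  obtain ⟨v, hv⟩ := hμ x
  exact ⟨v, mul_ne_zero (hf x) hv⟩

lemma SkewAlgebroid.lieDeriv_top_smul (𝒜 : SkewAlgebroid (SmoothFn E M) (Sec E F A))
    (X : Sec E F A) (f : SmoothFn E M) {n : ℕ} (μ : DForm E F A n) :
    𝒜.lieDeriv X n (f • μ) = f • 𝒜.lieDeriv X n μ + 𝒜.anchor X f • μ := by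
  have h := congrArg (fun η : DGraded E F A => η n)
    (LinearMap.congr_fun (𝒜.LG_mG X f) (Graded.single n μ))
  simpa [LG_apply] using h

namespace LieAlgebroid

variable (𝔄 : LieAlgebroid E F A) {π : MVec E F A 2} {ψ : DForm E F A 3}

lemma anchor_exp {f g : SmoothFn E M} (hf : ∀ x, f x = Real.exp (g x)) (X : Sec E F A) :
    𝔄.toSkew.anchor X f = f * 𝔄.toSkew.anchor X g := by
  ext x
  have hfg : (f : M → ℝ) = Real.exp ∘ g := funext hf
  have h := mvfderiv_comp_apply (I := 𝓘(ℝ, ℝ)) (I' := 𝓘(ℝ, E)) (g := Real.exp) (f := g) x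
    (Real.differentiable_exp (g x)).mdifferentiableAt (g.mdifferentiable x) (𝔄.anchor x (X x))
  change mvfderiv 𝓘(ℝ, E) f x (𝔄.anchor x (X x)) = f x * mvfderiv 𝓘(ℝ, E) g x (𝔄.anchor x (X x))
  have hexp : ∀ w : ℝ, fderiv ℝ Real.exp (g x) w = Real.exp (g x) * w := fun w => by
    rw [(Real.hasDerivAt_exp (g x)).hasFDerivAt.fderiv]
    simp [mul_comm]
  have hd : mvfderiv 𝓘(ℝ, ℝ) Real.exp (g x) = fderiv ℝ Real.exp (g x) :=
    mfderiv_eq_fderiv (f := Real.exp)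
  rw [hfg, h, hd]
  exact hexp _

/-- Skewness of `π` gives the sign: as a 1-vector, `H_g` is minus the `d_{π,ψ}`-differential of `g`.
-/
lemma apply_hamiltonian (α : DForm E F A 1) (g : SmoothFn E M) :
    α ![𝔄.hamiltonian π g] = -𝔄.toSkew.anchor (sharp π α) g := by
  have : (![𝔄.toSkew.d 0 (fnForm g), α] : Fin 2 → DForm E F A 1) =
      ![α, 𝔄.toSkew.d 0 (fnForm g)] ∘ Equiv.swap 0 1 := by
    ext1 i; fin_cases i <;> rfl
  rw [hamiltonian, apply_sharp, this, π.map_swap _ (by decide), ← apply_sharp,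
    SkewAlgebroid.d_zero_apply]
  rfl

lemma exists_isModularSection_hamiltonian {lam : DForm E F A (Module.finrank ℝ F)}
    (h : 𝔄.IsUnimodular π ψ lam) :
    ∃ g : SmoothFn E M, 𝔄.IsModularSection π ψ lam (𝔄.hamiltonian π g) := by
  obtain ⟨Z, g, hZ, hg⟩ := h
  -- A primitive `g` of `Z` for `d_{π,ψ}` gives `Z = H_{-g}`.
  refine ⟨-g, ?_⟩
  have : 𝔄.hamiltonian π (-g) = Z := by
    refine sec_eq_of_pairing fun α => ?_
    have h1 : vecMV Z ![α] = α ![Z] := rfl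
    rw [apply_hamiltonian, map_neg, neg_neg, ← h1, hg, dPiPsi, SkewAlgebroid.d_zero_apply]
    rfl
  rwa [this]

/-- After rescaling by `exp g`, a modular section `H_g` becomes zero. -/
lemma bdG_single_exp_smul {lam : DForm E F A (Module.finrank ℝ F)}
    {f g : SmoothFn E M} (hg : 𝔄.IsModularSection π ψ lam (𝔄.hamiltonian π g))
    (hf : ∀ x, f x = Real.exp (g x)) (hvol : IsVolumeForm (f • lam)) :
    𝔄.toSkew.bdG π ψ (Graded.single (Module.finrank ℝ F) (f • lam)) = 0 := by
  obtain ⟨X, hX, hXg⟩ := hg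
  refine SkewAlgebroid.bdG_single_eq_zero hvol fun α => ?_
  have h1 : α ![X] + α ![ySection π ψ] = -𝔄.toSkew.anchor (sharp π α) g := by
    rw [← 𝔄.apply_hamiltonian, hXg]
    exact (map_add (linOne α) X (ySection π ψ)).symm
  have h2 : 𝔄.toSkew.lieDeriv (sharp π α) (Module.finrank ℝ F) lam =
      (α ![X] + interior 2 0 2 rfl π (𝔄.toSkew.d 1 α) ![]) • lam := by
    rw [add_smul, hX α, sub_add_cancel]
  have h3 : α ![X] = -𝔄.toSkew.anchor (sharp π α) g - α ![ySection π ψ] := by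
    rw [← h1, add_sub_cancel_right]
  -- The derivative of `f = exp g` adds `ρ(π♯α) g` to the coefficient of `f λ`, cancelling the
  -- `-ρ(π♯α) g` that `Z_λ = H_g` contributes through `⟨α, X⟩`.
  rw [SkewAlgebroid.lieDeriv_top_smul, h2, 𝔄.anchor_exp hf, h3]
  simp only [smul_smul, ← add_smul, ← sub_smul]
  congr 1
  ring

lemma bd_hodgeStar {μ : DForm E F A (Module.finrank ℝ F)} (hμ : IsVolumeForm μ)
    (hbd : 𝔄.toSkew.bdG π ψ (Graded.single (Module.finrank ℝ F) μ) = 0)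
    {p k : ℕ} (h : k + 1 + p = Module.finrank ℝ F) (h' : k + (p + 1) = Module.finrank ℝ F)
    (V : MVec E F A p) :
    𝔄.bd π ψ k (hodgeStar μ p (k + 1) h V) = -hodgeStar μ (p + 1) k h' (𝔄.dPiPsi π ψ p V) := by
  have h1 := congrArg (fun η : DGraded E F A => η k) (SkewAlgebroid.bdG_IV_single hμ hbd V)
  simp only [SkewAlgebroid.bdG_apply, Graded.neg_apply] at h1
  rwa [IV_single_apply h, IV_single_apply h'] at h1

lemma mem_cocycles_iff {μ : DForm E F A (Module.finrank ℝ F)} (hμ : IsVolumeForm μ)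
    (hbd : 𝔄.toSkew.bdG π ψ (Graded.single (Module.finrank ℝ F) μ) = 0)
    {p k : ℕ} (h : k + p = Module.finrank ℝ F) (V : MVec E F A p) :
    V ∈ 𝔄.cocycles π ψ p ↔ hodgeStar μ p k h V ∈ 𝔄.cycles π ψ k := by
  rw [cocycles, LinearMap.mem_ker]
  cases k with
  | zero =>
    -- Here `p` is the rank: every 0-form is a cycle, and every `V` is a cocycle because its
    -- differential has degree above the rank.
    refine iff_of_true (eq_zero_of_IV_single hμ ?_) trivial
    ext q : 1
    exact IV_single_apply_of_ne (by omega) _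
  | succ k =>
    rw [cycles, LinearMap.mem_ker, 𝔄.bd_hodgeStar hμ hbd h (by omega), neg_eq_zero,
      map_eq_zero_iff _ (hodgeStar_injective hμ _)]

lemma mem_coboundaries_iff {μ : DForm E F A (Module.finrank ℝ F)} (hμ : IsVolumeForm μ)
    (hbd : 𝔄.toSkew.bdG π ψ (Graded.single (Module.finrank ℝ F) μ) = 0)
    {p k : ℕ} (h : k + p = Module.finrank ℝ F) (V : MVec E F A p) :
    V ∈ 𝔄.coboundaries π ψ p ↔ hodgeStar μ p k h V ∈ 𝔄.boundaries π ψ k := by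
  rw [boundaries, LinearMap.mem_range]
  cases p with
  | zero =>
    -- Here `k` is the rank: there are no nonzero coboundaries in degree 0, and no nonzero
    -- boundaries since forms of degree `k + 1` vanish.
    rw [coboundaries, Submodule.mem_bot, ← map_eq_zero_iff _ (hodgeStar_injective hμ h)]
    constructor
    · intro h0
      exact ⟨0, by rw [map_zero, h0]⟩
    · rintro ⟨W, hW⟩
      rw [← hW, form_eq_zero_of_rank_lt (by omega) W, map_zero]
  | succ p =>
    rw [coboundaries, LinearMap.mem_range]
    have h' : k + 1 + p = Module.finrank ℝ F := by omega
    constructor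
    · rintro ⟨U, rfl⟩
      -- The sign in this witness, and in `-U` below, absorbs the one in the intertwining relation.
      refine ⟨-hodgeStar μ p (k + 1) h' U, ?_⟩
      rw [map_neg, 𝔄.bd_hodgeStar hμ hbd h' h, neg_neg]
    · rintro ⟨W, hW⟩
      obtain ⟨U, rfl⟩ := hodgeStar_surjective hμ h' W
      refine ⟨-U, hodgeStar_injective hμ h ?_⟩
      rw [map_neg, map_neg, ← 𝔄.bd_hodgeStar hμ hbd h' h, hW]

lemma exists_cohomology_equiv_homology {μ : DForm E F A (Module.finrank ℝ F)}
    (hμ : IsVolumeForm μ)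
    (hbd : 𝔄.toSkew.bdG π ψ (Graded.single (Module.finrank ℝ F) μ) = 0)
    {p k : ℕ} (h : k + p = Module.finrank ℝ F) :
    ∃ Φ : 𝔄.Cohomology π ψ p ≃ₗ[ℝ] 𝔄.Homology π ψ k,
      ∀ V : 𝔄.cocycles π ψ p, ∃ W : 𝔄.cycles π ψ k,
        (W : DForm E F A k) = hodgeStar μ p k h (V : MVec E F A p) ∧
        Φ (𝔄.cohomologyClass π ψ p V) = 𝔄.homologyClass π ψ k W :=
  exists_cycleQuotient_equiv
    ((LinearEquiv.ofBijective (hodgeStar μ p k h) (hodgeStar_bijective hμ h)).restrictScalars ℝ)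
    (𝔄.mem_cocycles_iff hμ hbd h) (𝔄.mem_coboundaries_iff hμ hbd h)

lemma subsingleton_homology {k : ℕ} (hk : Module.finrank ℝ F < k) :
    Subsingleton (𝔄.Homology π ψ k) := by
  have : Subsingleton (𝔄.cycles π ψ k) :=
    ⟨fun a b => Subtype.ext ((form_eq_zero_of_rank_lt hk _).trans
      (form_eq_zero_of_rank_lt hk _).symm)⟩
  exact (Submodule.mkQ_surjective _).subsingleton

end LieAlgebroid

end Isomorphism

end TwistedPoisson

theorem mainTheorem7 {E M F : Type*} {A : M → Type*}
    [NormedAddCommGroup E] [NormedSpace ℝ E] [FiniteDimensional ℝ E]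
    [TopologicalSpace M] [ChartedSpace E M] [IsManifold 𝓘(ℝ, E) ∞ M] [T2Space M]
    [NormedAddCommGroup F] [NormedSpace ℝ F] [FiniteDimensional ℝ F]
    [TopologicalSpace (TotalSpace F A)] [∀ x, TopologicalSpace (A x)]
    [∀ x, AddCommGroup (A x)] [∀ x, Module ℝ (A x)]
    [FiberBundle F A] [VectorBundle ℝ F A] [ContMDiffVectorBundle ∞ F A 𝓘(ℝ, E)]
    (𝔄 : TwistedPoisson.LieAlgebroid E F A)
    (π : TwistedPoisson.MVec E F A 2) (ψ : TwistedPoisson.DForm E F A 3)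
    (hπψ : 𝔄.IsTwistedPoisson π ψ)
    (lam : TwistedPoisson.DForm E F A (Module.finrank ℝ F))
    (hlam : TwistedPoisson.IsVolumeForm lam)
    (hunimod : 𝔄.IsUnimodular π ψ lam) :
    (∃ g : TwistedPoisson.SmoothFn E M,
      𝔄.IsModularSection π ψ lam (𝔄.hamiltonian π g)) ∧
    (∀ g f : TwistedPoisson.SmoothFn E M,
      𝔄.IsModularSection π ψ lam (𝔄.hamiltonian π g) → (∀ x, f x = Real.exp (g x)) →
      (∀ (p k : ℕ) (h : k + p = Module.finrank ℝ F),
        Function.Bijective (TwistedPoisson.hodgeStar (f • lam) p k h)) ∧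
      (∀ (p k : ℕ) (h : k + 1 + p = Module.finrank ℝ F) (V : TwistedPoisson.MVec E F A p),
        𝔄.bd π ψ k (TwistedPoisson.hodgeStar (f • lam) p (k + 1) h V) =
          -TwistedPoisson.hodgeStar (f • lam) (p + 1) k (by omega) (𝔄.dPiPsi π ψ p V)) ∧
      (∀ (p k : ℕ) (h : k + p = Module.finrank ℝ F),
        ∃ Φ : 𝔄.Cohomology π ψ p ≃ₗ[ℝ] 𝔄.Homology π ψ k,
          ∀ V : 𝔄.cocycles π ψ p, ∃ W : 𝔄.cycles π ψ k,
            (W : TwistedPoisson.DForm E F A k) =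
              TwistedPoisson.hodgeStar (f • lam) p k h (V : TwistedPoisson.MVec E F A p) ∧
            Φ (𝔄.cohomologyClass π ψ p V) = 𝔄.homologyClass π ψ k W)) ∧
    (∀ k : ℕ, Module.finrank ℝ F < k → Subsingleton (𝔄.Homology π ψ k)) := by
  refine ⟨𝔄.exists_isModularSection_hamiltonian hunimod, fun g f hg hf => ?_,
    fun k hk => 𝔄.subsingleton_homology hk⟩
  have hvol : TwistedPoisson.IsVolumeForm (f • lam) :=
    hlam.smul fun x => by rw [hf]; exact Real.exp_ne_zero _
  have hbd := 𝔄.bdG_single_exp_smul hg hf hvol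
  exact ⟨fun p k h => TwistedPoisson.hodgeStar_bijective hvol h,
    fun p k h V => 𝔄.bd_hodgeStar hvol hbd h (by omega) V,
    fun p k h => 𝔄.exists_cohomology_equiv_homology hvol hbd h⟩
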